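/- Let $\lambda > 0$. A convex body in $\mathbb{R}^2$ is a compact convex set with non-empty interior. A convex body $K \subset \mathbb{R}^2$ is called $\lambda$-convex if for every $p \in \partial K$ there are a neighborhood $U_p$ of $p$ in $\mathbb{R}^2$ and a closed disc $B$ of radius $1/\lambda$ with $p \in \partial B$ such that $U_p \cap \partial K \subset B$. A $\lambda$-convex lens is a set with non-empty interior that is the intersection of two closed discs of radius $1/\lambda$; the two discs are allowed to coincide, so a disc of radius $1/\lambda$ counts as a (degenerate) lens. Write $|K|$ for the area of $K$ and $|\partial K|$ for the length of its boundary (which is finite). Then every $\lambda$-convex body $K \subset \mathbb{R}^2$ satisfies \[ |K| \ \ge\ \frac{|\partial K|}{2\lambda} - \frac{1}{\lambda^{2}} \sin\left(\frac{|\partial K|\,\lambda}{2}\right), \] and equality holds if and only if $K$ is a $\lambda$-convex lens. -/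

import Mathlib

open MeasureTheory Metric Topology

/-- A convex body in the Euclidean plane: a compact convex set with non-empty interior. -/
structure IsPlanarConvexBody (K : Set (EuclideanSpace ℝ (Fin 2))) : Prop where
  isCompact : IsCompact K
  convex : Convex ℝ K
  interior_nonempty : (interior K).Nonempty

/-- A convex body `K` in the plane is `lam`-convex if its boundary curvature is at least `lam` in
the barrier sense: near every boundary point `p`, the boundary lies in some closed disc of radius
`1 / lam` whose bounding circle passes through `p`. -/
structure IsLamConvexBody (lam : ℝ) (K : Set (EuclideanSpace ℝ (Fin 2))) : Prop
    extends IsPlanarConvexBody K where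
  barrier : ∀ p ∈ frontier K, ∃ U ∈ 𝓝 p, ∃ c : EuclideanSpace ℝ (Fin 2),
    p ∈ sphere c (1 / lam) ∧ U ∩ frontier K ⊆ closedBall c (1 / lam)

/-- A `lam`-convex lens: the intersection of two closed discs of radius `1 / lam`, with non-empty
interior. The two discs may coincide, so a disc of radius `1 / lam` is a (degenerate) lens. -/
def IsLamConvexLens (lam : ℝ) (L : Set (EuclideanSpace ℝ (Fin 2))) : Prop :=
  (interior L).Nonempty ∧
    ∃ a b : EuclideanSpace ℝ (Fin 2), L = closedBall a (1 / lam) ∩ closedBall b (1 / lam)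

/-- The area of a planar set: its two-dimensional Lebesgue measure. -/
noncomputable def planarArea (K : Set (EuclideanSpace ℝ (Fin 2))) : ℝ :=
  (volume K).toReal

/-- The length of the boundary of a planar set: the one-dimensional Hausdorff measure of its
topological boundary. -/
noncomputable def boundaryLength (K : Set (EuclideanSpace ℝ (Fin 2))) : ℝ :=
  (Measure.hausdorffMeasure 1 (frontier K)).toReal

/-! Parametrize the boundary by its outer normal angle. The barrier condition makes the support
point in each direction unique (`isSupp_unique`) and, by comparison with discs, Lipschitz in the
angle with constant `1 / lam` (`suppFn_le_disc`, `lipschitzWith_suppPt`). Its derivative is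
therefore a.e. `1 / lam * ρ` times the unit tangent with `0 ≤ ρ ≤ 1` (`ae_hasDerivAt_supp`). The
length is `1 / lam * ∫ ρ` (`boundaryLength_eq`). Cutting the circle of normals at `p` and `p + π`
gives the area as half of `(1 / lam) ^ 2` times a sum of two integrals of `ρ s * ρ t * sin (t - s)`
over `s < t`, one for each half circle (`planarArea_eq`). A suitable `p` gives both halves the same
mass `l` of `ρ` (`exists_halving`), so it suffices that each integral is at least `l - sin l`
(`Density.le_arcArea`).

For that, let `S` be the primitive of `ρ` and `T t = t - S t`, and split `t - s = u + v` into the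
increments of `S` and `T`. Then `0 ≤ u ≤ l` and `0 ≤ v ≤ M = π - l`, and concavity bounds `sin (u +
v)` below by the chord of `sin` over `[u, u + M]`, whose right end value is `sin (l - u)`. Against
`ρ s * ρ t` the part of the chord linear in `v` integrates to zero and the rest to `l - sin l`
(`Density.integral_minorant`).

Equality forces `v = 0` or `v = M` on the mass of `ρ`, so on each half `ρ` is the indicator of an
interval or of the complement of one (`Density.structure_of_eq`). Since the boundary closes up,
halves of different types occur only in degenerate form (`HasMidGap.toMidArc`). The boundary then
consists of two arcs and two corners, which is a lens (`isLamConvexLens_of_two_arcs`). Conversely,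
cutting a lens at the normals orthogonal to the line of centres gives equality in both halves
(`area_eq_of_lens`). -/

namespace LamConvex
open Set Filter Real

/-! ### Absolutely continuous primitives -/

lemma absCont_of_lipschitz {f : ℝ → ℝ} {C : NNReal} (hf : LipschitzWith C f) (a b : ℝ) :
    AbsolutelyContinuousOnInterval f a b :=
  (hf.lipschitzOnWith (s := uIcc a b)).absolutelyContinuousOnInterval

/-- Densities are only measurable, so derivatives exist only almost everywhere; the explicit
integrals below are evaluated by exhibiting absolutely continuous primitives. -/
lemma integral_eq_sub_of_absCont {f f' : ℝ → ℝ} {a b : ℝ}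
    (hf : AbsolutelyContinuousOnInterval f a b)
    (h : ∀ᵐ t, HasDerivAt f (f' t) t) : ∫ t in a..b, f' t = f b - f a := by
  rw [← hf.integral_deriv_eq_sub]
  apply intervalIntegral.integral_congr_ae
  filter_upwards [h] with t ht _ using ht.deriv.symm

lemma intervalIntegrable_of_bound {f : ℝ → ℝ} (hf : Measurable f) {C : ℝ} (hC : ∀ t, |f t| ≤ C)
    (a b : ℝ) : IntervalIntegrable f volume a b := by
  refine (intervalIntegrable_const (c := C)).mono_fun hf.aestronglyMeasurable ?_
  filter_upwards with t
  simpa using (hC t).trans (le_abs_self C)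

lemma locallyIntegrable_of_bound {f : ℝ → ℝ} (hf : Measurable f) {C : ℝ} (hC : ∀ t, |f t| ≤ C) :
    LocallyIntegrable f volume := by
  refine (locallyIntegrable_const C).mono hf.aestronglyMeasurable ?_
  filter_upwards with t
  simpa using (hC t).trans (le_abs_self C)

/-- A curvature density: measurable with values in `[0, 1]`. -/
structure Density (ρ : ℝ → ℝ) : Prop where
  meas : Measurable ρ
  nonneg : ∀ t, 0 ≤ ρ t
  le_one : ∀ t, ρ t ≤ 1

/-- The primitive of a density. -/
noncomputable def prim (ρ : ℝ → ℝ) (t : ℝ) : ℝ := ∫ s in (0 : ℝ)..t, ρ s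

namespace Density
variable {ρ : ℝ → ℝ}

lemma abs_le (h : Density ρ) (t : ℝ) : |ρ t| ≤ 1 := by
  rw [abs_of_nonneg (h.nonneg t)]; exact h.le_one t

lemma intervalIntegrable (h : Density ρ) (a b : ℝ) : IntervalIntegrable ρ volume a b :=
  intervalIntegrable_of_bound h.meas h.abs_le a b

lemma prim_sub (h : Density ρ) (a b : ℝ) : prim ρ b - prim ρ a = ∫ s in a..b, ρ s :=
  intervalIntegral.integral_interval_sub_left (h.intervalIntegrable _ _)
    (h.intervalIntegrable _ _)

lemma prim_zero : prim ρ 0 = 0 := by simp [prim]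

lemma prim_mono (h : Density ρ) : Monotone (prim ρ) := fun a b hab => by
  have := h.prim_sub a b
  have h2 := intervalIntegral.integral_nonneg (μ := volume) hab (fun u _ => h.nonneg u)
  linarith

lemma prim_sub_le (h : Density ρ) {a b : ℝ} (hab : a ≤ b) : prim ρ b - prim ρ a ≤ b - a := by
  rw [h.prim_sub]
  have := intervalIntegral.integral_mono_on hab (h.intervalIntegrable a b)
    (intervalIntegrable_const (c := (1 : ℝ))) (fun u _ => h.le_one u)
  simpa using this

lemma prim_lipschitz (h : Density ρ) : LipschitzWith 1 (prim ρ) := by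
  apply LipschitzWith.of_dist_le_mul
  intro a b
  wlog hab : a ≤ b generalizing a b
  · rw [dist_comm, dist_comm a]; exact this b a (le_of_not_ge hab)
  rw [dist_comm, dist_comm a, Real.dist_eq, Real.dist_eq, abs_of_nonneg (sub_nonneg.2 hab),
    abs_of_nonneg (sub_nonneg.2 (h.prim_mono hab))]
  simpa using h.prim_sub_le hab

lemma prim_continuous (h : Density ρ) : Continuous (prim ρ) := h.prim_lipschitz.continuous

lemma ae_hasDerivAt_prim (h : Density ρ) : ∀ᵐ t, HasDerivAt (prim ρ) (ρ t) t := by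
  filter_upwards [LocallyIntegrable.ae_hasDerivAt_integral
    (locallyIntegrable_of_bound h.meas h.abs_le)] with t ht using ht 0

end Density

/-- A primitive of the product of a density and a continuous function. -/
lemma Density.ae_hasDerivAt_integral_mul {ρ : ℝ → ℝ} (h : Density ρ) {g : ℝ → ℝ}
    (hg : Continuous g) :
    ∀ᵐ t, HasDerivAt (fun t => ∫ s in (0 : ℝ)..t, ρ s * g s) (ρ t * g t) t := by
  have : LocallyIntegrable (fun s => ρ s * g s) volume := by
    refine (hg.abs.locallyIntegrable).mono (h.meas.mul hg.measurable).aestronglyMeasurable ?_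
    filter_upwards with t
    simpa [abs_mul] using mul_le_of_le_one_left (abs_nonneg (g t)) (h.abs_le t)
  filter_upwards [LocallyIntegrable.ae_hasDerivAt_integral this] with t ht using ht 0

lemma Density.intervalIntegrable_mul {ρ : ℝ → ℝ} (h : Density ρ) {g : ℝ → ℝ}
    (hg : Continuous g) (a b : ℝ) : IntervalIntegrable (fun s => ρ s * g s) volume a b :=
  (h.intervalIntegrable a b).mul_continuousOn hg.continuousOn

lemma Density.absCont_integral_mul {ρ : ℝ → ℝ} (h : Density ρ) {g : ℝ → ℝ}
    (hg : Continuous g) {b : ℝ} :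
    AbsolutelyContinuousOnInterval (fun t => ∫ s in (0 : ℝ)..t, ρ s * g s) 0 b :=
  (h.intervalIntegrable_mul hg 0 b).absolutelyContinuousOnInterval_intervalIntegral (by simp)

lemma absCont_comp {f g : ℝ → ℝ} {C : NNReal} (hg : ContDiff ℝ 1 g) (hf : LipschitzWith C f)
    (a b : ℝ) : AbsolutelyContinuousOnInterval (fun t => g (f t)) a b := by
  obtain ⟨B, hB⟩ := (isCompact_uIcc (a := a) (b := b)).exists_bound_of_continuousOn
    hf.continuous.continuousOn
  obtain ⟨D, hD⟩ := (hg.contDiffOn (s := closedBall 0 B)).exists_lipschitzOnWith (by decide)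
    (convex_closedBall _ _) (isCompact_closedBall _ _)
  refine (hD.comp (hf.lipschitzOnWith (s := uIcc a b)) ?_).absolutelyContinuousOnInterval
  intro t ht
  simpa using hB t ht

/-! ### The one-dimensional rearrangement-free inequality -/

/-- Primitive of `u ↦ sin (l - u) - sin u`; it is symmetric under `y ↦ l - y`. -/
noncomputable def symPrim (l y : ℝ) : ℝ := cos (l - y) + cos y - 1 - cos l

lemma hasDerivAt_symPrim (l y : ℝ) : HasDerivAt (symPrim l) (sin (l - y) - sin y) y := by
  have h1 : HasDerivAt (fun y : ℝ => l - y) (-1) y := by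
    simpa using (hasDerivAt_id y).const_sub l
  have := ((h1.cos.add (hasDerivAt_cos y)).sub_const 1).sub_const (cos l)
  exact this.congr_deriv (by ring)

/-- Companion of `symPrim`; the constants make both vanish at `y = l`, which removes the boundary
terms in `integral_minorant`. -/
noncomputable def skewPrim (l y : ℝ) : ℝ := sin y - sin (l - y) - sin l

lemma hasDerivAt_skewPrim (l y : ℝ) : HasDerivAt (skewPrim l) (cos y + cos (l - y)) y := by
  have h1 : HasDerivAt (fun y : ℝ => l - y) (-1) y := by
    simpa using (hasDerivAt_id y).const_sub l
  have := ((hasDerivAt_sin y).sub h1.sin).sub_const (sin l)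
  exact this.congr_deriv (by ring)

lemma contDiff_symPrim (l : ℝ) : ContDiff ℝ 1 (symPrim l) := by
  unfold symPrim; fun_prop

lemma contDiff_skewPrim (l : ℝ) : ContDiff ℝ 1 (skewPrim l) := by
  unfold skewPrim; fun_prop

/-- The complementary primitive `t - ∫₀ᵗ ρ`. -/
noncomputable def coprim (ρ : ℝ → ℝ) (t : ℝ) : ℝ := t - prim ρ t

/-- The affine-in-`v` minorant of `sin (u + v)`. -/
noncomputable def minorant (l M u v : ℝ) : ℝ := sin u + v / M * (sin (l - u) - sin u)

namespace Density
variable {ρ : ℝ → ℝ}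

lemma coprim_continuous (h : Density ρ) : Continuous (coprim ρ) :=
  continuous_id.sub h.prim_continuous

lemma coprim_mono (h : Density ρ) : Monotone (coprim ρ) := fun a b hab => by
  have := h.prim_sub_le hab
  unfold coprim; linarith

/-- The factors depending on `prim ρ s` alone have elementary primitives. Those containing `coprim ρ
s` do not; the addition formulas reduce them to two integrals, kept as unknowns for the outer
integration. -/
lemma integral_minorant_inner (h : Density ρ) (l M t : ℝ) :
    ∫ s in (0 : ℝ)..t, ρ s * minorant l M (prim ρ t - prim ρ s) (coprim ρ t - coprim ρ s)
      = 1 - cos (prim ρ t) + 1 / M * (coprim ρ t * symPrim l (prim ρ t)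
        - ((sin (l - prim ρ t) - sin (prim ρ t)) * (∫ s in (0 : ℝ)..t, ρ s * (coprim ρ s * cos (prim ρ s)))
          + (cos (prim ρ t) + cos (l - prim ρ t)) * ∫ s in (0 : ℝ)..t, ρ s * (coprim ρ s * sin (prim ρ s)))) := by
  have cC : Continuous fun s => coprim ρ s * cos (prim ρ s) :=
    h.coprim_continuous.mul (continuous_cos.comp h.prim_continuous)
  have cD : Continuous fun s => coprim ρ s * sin (prim ρ s) :=
    h.coprim_continuous.mul (continuous_sin.comp h.prim_continuous)
  set y := prim ρ t with hy
  set τ := coprim ρ t with hτ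
  have key := integral_eq_sub_of_absCont (a := 0) (b := t)
    (f := fun s => cos (y - prim ρ s) + 1 / M * (-τ * symPrim l (y - prim ρ s)
        - ((sin (l - y) - sin y) * (∫ s in (0 : ℝ)..s, ρ s * (coprim ρ s * cos (prim ρ s)))
          + (cos y + cos (l - y)) * ∫ s in (0 : ℝ)..s, ρ s * (coprim ρ s * sin (prim ρ s)))))
    (f' := fun s => ρ s * minorant l M (y - prim ρ s) (τ - coprim ρ s)) ?_ ?_
  · rw [key, ← hy]
    simp only [sub_self, prim_zero, sub_zero, cos_zero, intervalIntegral.integral_same]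
    have : symPrim l 0 = 0 := by simp [symPrim]
    rw [this]; ring
  · have e1 : AbsolutelyContinuousOnInterval (fun s => cos (y - prim ρ s)) 0 t :=
      absCont_comp (g := fun z => cos (y - z)) (by fun_prop) h.prim_lipschitz 0 t
    have e2 : AbsolutelyContinuousOnInterval (fun s => symPrim l (y - prim ρ s)) 0 t :=
      absCont_comp (g := fun z => symPrim l (y - z))
        ((contDiff_symPrim l).comp (by fun_prop)) h.prim_lipschitz 0 t
    exact e1.fun_add ((((e2.const_mul (-τ)).fun_sub (((h.absCont_integral_mul cC).const_mul _).fun_add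
      ((h.absCont_integral_mul cD).const_mul _)))).const_mul _)
  · filter_upwards [h.ae_hasDerivAt_prim, h.ae_hasDerivAt_integral_mul cC,
      h.ae_hasDerivAt_integral_mul cD] with s h1 h2 h3
    have h4 := h1.const_sub y
    have h5 := (hasDerivAt_symPrim l (y - prim ρ s)).comp s h4
    have := h4.cos.add (((h5.const_mul (-τ)).sub ((h2.const_mul (sin (l - y) - sin y)).add
      (h3.const_mul (cos y + cos (l - y))))).const_mul (1 / M))
    refine this.congr_deriv ?_
    have e1 : sin (l - (y - prim ρ s)) = sin (l - y) * cos (prim ρ s) + cos (l - y) * sin (prim ρ s) := by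
      rw [← sin_add]; congr 1; ring
    unfold minorant
    rw [e1, sin_sub y]
    ring

/-- `M` drops out: in the primitive, the `1 / M` term pairs functions vanishing at `b` with
integrals vanishing at `0`. -/
lemma integral_minorant (h : Density ρ) (M b : ℝ) :
    ∫ t in (0 : ℝ)..b, ρ t * ∫ s in (0 : ℝ)..t,
      ρ s * minorant (prim ρ b) M (prim ρ t - prim ρ s) (coprim ρ t - coprim ρ s)
      = prim ρ b - sin (prim ρ b) := by
  set l := prim ρ b with hl
  simp_rw [h.integral_minorant_inner l M]
  have cC : Continuous fun s => coprim ρ s * cos (prim ρ s) :=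
    h.coprim_continuous.mul (continuous_cos.comp h.prim_continuous)
  have cD : Continuous fun s => coprim ρ s * sin (prim ρ s) :=
    h.coprim_continuous.mul (continuous_sin.comp h.prim_continuous)
  rw [integral_eq_sub_of_absCont (a := 0) (b := b)
    (f := fun t => prim ρ t - sin (prim ρ t) - 1 / M *
      (symPrim l (prim ρ t) * (∫ s in (0 : ℝ)..t, ρ s * (coprim ρ s * cos (prim ρ s)))
       + skewPrim l (prim ρ t) * (∫ s in (0 : ℝ)..t, ρ s * (coprim ρ s * sin (prim ρ s)))))]
  · have e1 : symPrim l l = 0 := by simp [symPrim]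
    have e2 : skewPrim l l = 0 := by simp [skewPrim]
    simp [← hl, e1, e2, prim_zero]
  · have e1 : AbsolutelyContinuousOnInterval (fun t => prim ρ t - sin (prim ρ t)) 0 b :=
      absCont_comp (g := fun z => z - sin z) (by fun_prop) h.prim_lipschitz 0 b
    have e2 := absCont_comp (contDiff_symPrim l) h.prim_lipschitz 0 b
    have e3 := absCont_comp (contDiff_skewPrim l) h.prim_lipschitz 0 b
    exact e1.fun_sub (((e2.fun_mul (h.absCont_integral_mul cC)).fun_add
      (e3.fun_mul (h.absCont_integral_mul cD))).const_mul _)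
  · filter_upwards [h.ae_hasDerivAt_prim, h.ae_hasDerivAt_integral_mul cC,
      h.ae_hasDerivAt_integral_mul cD] with t h1 h2 h3
    have h5 := (hasDerivAt_symPrim l (prim ρ t)).comp t h1
    have h6 := (hasDerivAt_skewPrim l (prim ρ t)).comp t h1
    have := (h1.sub h1.sin).sub (((h5.mul h2).add (h6.mul h3)).const_mul (1 / M))
    refine this.congr_deriv ?_
    simp only [Function.comp_apply]
    -- Differentiating the two inner integrals produces exactly this combination; it supplies the
    -- `coprim ρ t * symPrim` term of the integrand.
    have e1 : symPrim l (prim ρ t) * cos (prim ρ t) + skewPrim l (prim ρ t) * sin (prim ρ t)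
        = - symPrim l (prim ρ t) := by
      have a1 : cos l = cos (l - prim ρ t) * cos (prim ρ t) - sin (l - prim ρ t) * sin (prim ρ t) := by
        rw [← cos_add]; congr 1; ring
      have a2 : cos (l - prim ρ t) = cos l * cos (prim ρ t) + sin l * sin (prim ρ t) := cos_sub _ _
      have a3 := sin_sq_add_cos_sq (prim ρ t)
      unfold symPrim skewPrim
      linear_combination a3 - a1 + a2
    linear_combination (-1 / M * coprim ρ t * ρ t) * e1

end Density

/-- The minorant is the chord of `sin` over `[u, u + M]`, because `u + M = π - (l - u)`. -/
lemma minorant_le_sin {l M u v : ℝ} (hM : M = π - l) (hu : 0 ≤ u) (hul : u ≤ l) (hv : 0 ≤ v)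
    (hvM : v ≤ M) : minorant l M u v ≤ sin (u + v) := by
  unfold minorant
  -- The end `v = M` is separate because `M = 0` is possible, and then `v / M` is `0` by convention.
  rcases hvM.eq_or_lt with rfl | hlt
  · rcases eq_or_ne v 0 with h0 | h0
    · simp [h0]
    · rw [div_self h0, hM]
      have : u + (π - l) = π - (l - u) := by ring
      rw [this, sin_pi_sub]; simp
  have hM0 : 0 < M := lt_of_le_of_lt hv hlt
  have m1 : u ∈ Icc 0 π := ⟨hu, by linarith⟩
  have m2 : u + M ∈ Icc 0 π := ⟨by linarith, by linarith⟩
  have a1 : 0 ≤ 1 - v / M := by rw [sub_nonneg, div_le_one hM0]; exact hlt.le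
  have a2 : 0 ≤ v / M := by positivity
  have hc := strictConcaveOn_sin_Icc.concaveOn.2 m1 m2 a1 a2 (by ring)
  have e1 : sin (u + M) = sin (l - u) := by
    rw [← sin_pi_sub (l - u), hM]; congr 1; ring
  have e2 : (1 - v / M) • u + (v / M) • (u + M) = u + v := by
    simp only [smul_eq_mul]; field_simp; ring
  rw [e1, e2] at hc
  simp only [smul_eq_mul] at hc
  linarith

lemma minorant_lt_sin {l M u v : ℝ} (hM : M = π - l) (hu : 0 ≤ u) (hul : u ≤ l) (hv : 0 < v)
    (hvM : v < M) : minorant l M u v < sin (u + v) := by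
  unfold minorant
  have hM0 : 0 < M := hv.trans hvM
  have m1 : u ∈ Icc 0 π := ⟨hu, by linarith⟩
  have m2 : u + M ∈ Icc 0 π := ⟨by linarith, by linarith⟩
  have a1 : 0 < 1 - v / M := by rw [sub_pos, div_lt_one hM0]; exact hvM
  have a2 : 0 < v / M := by positivity
  have hc := strictConcaveOn_sin_Icc.2 m1 m2 (by linarith) a1 a2 (by ring)
  have e1 : sin (u + M) = sin (l - u) := by
    rw [← sin_pi_sub (l - u), hM]; congr 1; ring
  have e2 : (1 - v / M) • u + (v / M) • (u + M) = u + v := by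
    simp only [smul_eq_mul]; field_simp; ring
  rw [e1, e2] at hc
  simp only [smul_eq_mul] at hc
  linarith

namespace Density
variable {ρ : ℝ → ℝ}

lemma coprim_add_prim (ρ : ℝ → ℝ) (s t : ℝ) :
    (prim ρ t - prim ρ s) + (coprim ρ t - coprim ρ s) = t - s := by
  unfold coprim; ring

lemma minorant_le (h : Density ρ) {s t : ℝ} (hs : 0 ≤ s) (hst : s ≤ t) (ht : t ≤ π) :
    minorant (prim ρ π) (π - prim ρ π) (prim ρ t - prim ρ s) (coprim ρ t - coprim ρ s)
      ≤ sin (t - s) := by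
  rw [← coprim_add_prim ρ s t]
  have a1 := h.prim_mono hs
  have a2 := h.prim_mono hst
  have a3 := h.prim_mono ht
  have b1 := h.coprim_mono hs
  have b2 := h.coprim_mono hst
  have b3 := h.coprim_mono ht
  have c0 : prim ρ 0 = 0 := prim_zero
  have c1 : coprim ρ 0 = 0 := by simp [coprim, c0]
  have c2 : coprim ρ π = π - prim ρ π := rfl
  exact minorant_le_sin rfl (by linarith) (by linarith) (by linarith) (by linarith)

lemma minorant_lt (h : Density ρ) {s t : ℝ} (hs : 0 ≤ s) (hst : s ≤ t) (ht : t ≤ π)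
    (h1 : coprim ρ t ≠ coprim ρ s) (h2 : coprim ρ t - coprim ρ s ≠ π - prim ρ π) :
    minorant (prim ρ π) (π - prim ρ π) (prim ρ t - prim ρ s) (coprim ρ t - coprim ρ s)
      < sin (t - s) := by
  rw [← coprim_add_prim ρ s t]
  have a1 := h.prim_mono hs
  have a2 := h.prim_mono hst
  have a3 := h.prim_mono ht
  have b1 := h.coprim_mono hs
  have b2 := h.coprim_mono hst
  have b3 := h.coprim_mono ht
  have c0 : prim ρ 0 = 0 := prim_zero
  have c1 : coprim ρ 0 = 0 := by simp [coprim, c0]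
  have c2 : coprim ρ π = π - prim ρ π := rfl
  exact minorant_lt_sin rfl (by linarith) (by linarith)
    (sub_pos.2 (lt_of_le_of_ne b2 h1.symm)) (lt_of_le_of_ne (by linarith) h2)

lemma continuous_minorant (h : Density ρ) (l M : ℝ) :
    Continuous fun z : ℝ × ℝ =>
      minorant l M (prim ρ z.2 - prim ρ z.1) (coprim ρ z.2 - coprim ρ z.1) := by
  have := h.prim_continuous
  have := h.coprim_continuous
  unfold minorant
  fun_prop

/-- Nonnegative integrand measuring the defect in the inequality. -/
noncomputable def defect (ρ : ℝ → ℝ) (s t : ℝ) : ℝ :=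
  sin (t - s) - minorant (prim ρ π) (π - prim ρ π) (prim ρ t - prim ρ s)
    (coprim ρ t - coprim ρ s)

lemma continuous_defect (h : Density ρ) : Continuous fun z : ℝ × ℝ => defect ρ z.1 z.2 := by
  have := h.continuous_minorant (prim ρ π) (π - prim ρ π)
  unfold defect
  fun_prop

/-- Half of the double integral giving the area of a convex arc of total turning `π`. -/
noncomputable def arcArea (ρ : ℝ → ℝ) : ℝ :=
  ∫ t in (0 : ℝ)..π, ρ t * ∫ s in (0 : ℝ)..t, ρ s * sin (t - s)

/-- Absorbing `ρ` into the measure gives a locally finite measure without atoms and a jointly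
continuous integrand, so continuity of parametric integrals applies. -/
lemma continuous_integral_mul (h : Density ρ) {g : ℝ → ℝ → ℝ}
    (hg : Continuous fun z : ℝ × ℝ => g z.1 z.2) :
    Continuous fun t => ∫ s in (0 : ℝ)..t, ρ s * g s t := by
  set μ : Measure ℝ := volume.withDensity fun t => ENNReal.ofReal (ρ t) with hμ
  have hle : μ ≤ volume := by
    have : μ ≤ volume.withDensity 1 := withDensity_mono <| by
      filter_upwards with t
      simpa using h.le_one t
    simpa using this
  have : IsLocallyFiniteMeasure μ := Measure.isLocallyFiniteMeasure_of_le hle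
  have : NullSingletonClass μ := ⟨fun x => le_antisymm ((hle _).trans (by simp)) bot_le⟩
  have key := intervalIntegral.continuous_parametric_intervalIntegral_of_continuous (μ := μ) (a₀ := 0)
    (f := fun t s => g s t) (hg.comp continuous_swap) continuous_id
  convert key using 2 with t
  simp only [intervalIntegral, id]
  have e : ∀ a b : ℝ, ∫ s in Ioc a b, g s t ∂μ = ∫ s in Ioc a b, ρ s * g s t := by
    intro a b
    rw [hμ, setIntegral_withDensity_eq_setIntegral_toReal_smul (by
      exact h.meas.ennreal_ofReal) (by simp) _ measurableSet_Ioc]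
    refine setIntegral_congr_fun measurableSet_Ioc fun s _ => ?_
    simp [ENNReal.toReal_ofReal (h.nonneg s)]
  rw [e, e]

lemma arcArea_eq (h : Density ρ) :
    arcArea ρ = prim ρ π - sin (prim ρ π)
      + ∫ t in (0 : ℝ)..π, ρ t * ∫ s in (0 : ℝ)..t, ρ s * defect ρ s t := by
  rw [← h.integral_minorant (π - prim ρ π) π, ← intervalIntegral.integral_add]
  · unfold arcArea
    congr 1; ext t
    rw [← mul_add, ← intervalIntegral.integral_add]
    · congr 2; ext s; unfold defect; ring
    · exact h.intervalIntegrable_mul ((h.continuous_minorant _ _).comp (by fun_prop :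
        Continuous fun s : ℝ => (s, t))) _ _
    · exact h.intervalIntegrable_mul (h.continuous_defect.comp (by fun_prop :
        Continuous fun s : ℝ => (s, t))) _ _
  · exact h.intervalIntegrable_mul (h.continuous_integral_mul (h.continuous_minorant _ _)) _ _
  · exact h.intervalIntegrable_mul (h.continuous_integral_mul h.continuous_defect) _ _

lemma defect_nonneg (h : Density ρ) {s t : ℝ} (hs : 0 ≤ s) (hst : s ≤ t) (ht : t ≤ π) :
    0 ≤ defect ρ s t := sub_nonneg.2 (h.minorant_le hs hst ht)

lemma inner_defect_nonneg (h : Density ρ) {t : ℝ} (h0 : 0 ≤ t) (ht : t ≤ π) :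
    0 ≤ ∫ s in (0 : ℝ)..t, ρ s * defect ρ s t :=
  intervalIntegral.integral_nonneg h0 fun s hs =>
    mul_nonneg (h.nonneg s) (h.defect_nonneg hs.1 hs.2 ht)

theorem le_arcArea (h : Density ρ) : prim ρ π - sin (prim ρ π) ≤ arcArea ρ := by
  rw [h.arcArea_eq, le_add_iff_nonneg_right]
  exact intervalIntegral.integral_nonneg pi_pos.le fun t ht =>
    mul_nonneg (h.nonneg t) (h.inner_defect_nonneg ht.1 ht.2)

/-- Otherwise `defect` has a positive minimum `c` on the compact rectangle, and the double integral
is at least `c` times the masses of `ρ` on the two sides, although equality makes it vanish. -/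
lemma exists_coprim_sub_of_eq (h : Density ρ) (heq : arcArea ρ = prim ρ π - sin (prim ρ π))
    {s₁ s₂ t₁ t₂ : ℝ} (hs : 0 ≤ s₁) (hs' : s₁ ≤ s₂) (hst : s₂ ≤ t₁) (ht' : t₁ ≤ t₂) (ht : t₂ ≤ π)
    (ms : prim ρ s₁ < prim ρ s₂) (mt : prim ρ t₁ < prim ρ t₂) :
    ∃ s ∈ Icc s₁ s₂, ∃ t ∈ Icc t₁ t₂,
      coprim ρ t = coprim ρ s ∨ coprim ρ t - coprim ρ s = π - prim ρ π := by
  by_contra! hcon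
  have hcomp : IsCompact (Icc s₁ s₂ ×ˢ Icc t₁ t₂) := isCompact_Icc.prod isCompact_Icc
  obtain ⟨z, hz, hmin⟩ := hcomp.exists_isMinOn
    ⟨(s₁, t₁), ⟨left_mem_Icc.2 hs', left_mem_Icc.2 ht'⟩⟩ h.continuous_defect.continuousOn
  set c := defect ρ z.1 z.2 with hc
  have hmin' : ∀ s ∈ Icc s₁ s₂, ∀ t ∈ Icc t₁ t₂, c ≤ defect ρ s t := fun s hs t ht =>
    isMinOn_iff.1 hmin (s, t) ⟨hs, ht⟩
  have hc0 : 0 < c := by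
    obtain ⟨n1, n2⟩ := hcon z.1 hz.1 z.2 hz.2
    exact sub_pos.2 (h.minorant_lt (hs.trans hz.1.1) (hz.1.2.trans (hst.trans hz.2.1))
      (hz.2.2.trans ht) n1 n2)
  have hint : ∀ t, IntervalIntegrable (fun s => ρ s * defect ρ s t) volume 0 t := fun t =>
    h.intervalIntegrable_mul (h.continuous_defect.comp (by fun_prop :
        Continuous fun s : ℝ => (s, t))) _ _
  have inner : ∀ t ∈ Icc t₁ t₂, c * (prim ρ s₂ - prim ρ s₁)
      ≤ ∫ s in (0 : ℝ)..t, ρ s * defect ρ s t := by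
    intro t htt
    calc c * (prim ρ s₂ - prim ρ s₁) = ∫ s in s₁..s₂, ρ s * c := by
          rw [h.prim_sub, intervalIntegral.integral_mul_const, mul_comm]
      _ ≤ ∫ s in s₁..s₂, ρ s * defect ρ s t := by
          refine intervalIntegral.integral_mono_on hs' ((h.intervalIntegrable _ _).mul_const _)
            (h.intervalIntegrable_mul (h.continuous_defect.comp (by fun_prop :
              Continuous fun s : ℝ => (s, t))) _ _) fun s hss => ?_
          exact mul_le_mul_of_nonneg_left (hmin' s hss t htt) (h.nonneg s)
      _ ≤ ∫ s in (0 : ℝ)..t, ρ s * defect ρ s t := by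
          refine intervalIntegral.integral_mono_interval hs hs' (hst.trans htt.1) ?_ (hint t)
          refine (ae_restrict_iff' measurableSet_Ioc).2 (Eventually.of_forall fun s hss => ?_)
          exact mul_nonneg (h.nonneg s) (h.defect_nonneg hss.1.le hss.2 (htt.2.trans ht))
  have hcont := h.continuous_integral_mul h.continuous_defect
  have outer : c * (prim ρ s₂ - prim ρ s₁) * (prim ρ t₂ - prim ρ t₁)
      ≤ ∫ t in (0 : ℝ)..π, ρ t * ∫ s in (0 : ℝ)..t, ρ s * defect ρ s t := by
    calc c * (prim ρ s₂ - prim ρ s₁) * (prim ρ t₂ - prim ρ t₁)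
        = ∫ t in t₁..t₂, ρ t * (c * (prim ρ s₂ - prim ρ s₁)) := by
          rw [h.prim_sub t₁, intervalIntegral.integral_mul_const, mul_comm]
      _ ≤ ∫ t in t₁..t₂, ρ t * ∫ s in (0 : ℝ)..t, ρ s * defect ρ s t := by
          refine intervalIntegral.integral_mono_on ht' ((h.intervalIntegrable _ _).mul_const _)
            (h.intervalIntegrable_mul hcont _ _) fun t htt => ?_
          exact mul_le_mul_of_nonneg_left (inner t htt) (h.nonneg t)
      _ ≤ _ := by
          refine intervalIntegral.integral_mono_interval (hs.trans (hs'.trans hst)) ht' ht ?_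
            (h.intervalIntegrable_mul hcont _ _)
          refine (ae_restrict_iff' measurableSet_Ioc).2 (Eventually.of_forall fun t htt => ?_)
          exact mul_nonneg (h.nonneg t) (h.inner_defect_nonneg htt.1.le htt.2)
  have := h.arcArea_eq
  have : 0 < c * (prim ρ s₂ - prim ρ s₁) * (prim ρ t₂ - prim ρ t₁) :=
    mul_pos (mul_pos hc0 (sub_pos.2 ms)) (sub_pos.2 mt)
  linarith

end Density

/-! ### Shape of the densities attaining equality. -/

lemma exists_last_eq {f : ℝ → ℝ} (hf : Continuous f) (hm : Monotone f) {a b : ℝ} (hab : a ≤ b) :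
    ∃ c ∈ Icc a b, f c = f a ∧ ∀ t, c < t → t ≤ b → f a < f t := by
  have hcl : IsCompact (Icc a b ∩ f ⁻¹' {f a}) :=
    isCompact_Icc.inter_right (isClosed_singleton.preimage hf)
  obtain ⟨c, hc, hmax⟩ := hcl.exists_isGreatest ⟨a, left_mem_Icc.2 hab, rfl⟩
  refine ⟨c, hc.1, hc.2, fun t hct htb => lt_of_le_of_ne (hm (hc.1.1.trans hct.le)) fun he => ?_⟩
  exact hct.not_ge (hmax ⟨⟨hc.1.1.trans hct.le, htb⟩, he.symm⟩)

lemma exists_first_eq {f : ℝ → ℝ} (hf : Continuous f) (hm : Monotone f) {a b : ℝ} (hab : a ≤ b) :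
    ∃ c ∈ Icc a b, f c = f b ∧ ∀ t, a ≤ t → t < c → f t < f b := by
  have hcl : IsCompact (Icc a b ∩ f ⁻¹' {f b}) :=
    isCompact_Icc.inter_right (isClosed_singleton.preimage hf)
  obtain ⟨c, hc, hmin⟩ := hcl.exists_isLeast ⟨b, right_mem_Icc.2 hab, rfl⟩
  refine ⟨c, hc.1, hc.2, fun t hat htc => lt_of_le_of_ne (hm (htc.le.trans hc.1.2)) fun he => ?_⟩
  exact htc.not_ge (hmin ⟨⟨hat, htc.le.trans hc.1.2⟩, he⟩)

/-- `f` is constant on `[a, b]`. -/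
def ConstOn (f : ℝ → ℝ) (a b : ℝ) : Prop := ∀ t ∈ Icc a b, f t = f a

lemma constOn_of_monotone {f : ℝ → ℝ} (hm : Monotone f) {a b : ℝ} (h : f a = f b) :
    ConstOn f a b := fun _ ht => le_antisymm ((hm ht.2).trans h.ge) (hm ht.1)

namespace Density
variable {ρ : ℝ → ℝ}

/-- In the equality case the density is, on `[0, π]`, the indicator of an interval or of the
complement of an interval. -/
theorem structure_of_eq (h : Density ρ) (heq : arcArea ρ = prim ρ π - sin (prim ρ π))
    (hl : 0 < prim ρ π) :
    (∃ γ δ, 0 ≤ γ ∧ γ ≤ δ ∧ δ ≤ π ∧ ConstOn (prim ρ) 0 γ ∧ ConstOn (coprim ρ) γ δ ∧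
      ConstOn (prim ρ) δ π) ∨
    (∃ α β, 0 ≤ α ∧ α ≤ β ∧ β ≤ π ∧ ConstOn (coprim ρ) 0 α ∧ ConstOn (prim ρ) α β ∧
      ConstOn (coprim ρ) β π) := by
  have S0 : prim ρ 0 = 0 := prim_zero
  have T0 : coprim ρ 0 = 0 := by simp [coprim, S0]
  have Sm := h.prim_mono
  have Tm := h.coprim_mono
  have Sc := h.prim_continuous
  have Tc := h.coprim_continuous
  have TS : ∀ t, coprim ρ t = t - prim ρ t := fun t => rfl
  -- `[a, b]` is the smallest subinterval of `[0, π]` carrying all the mass of `ρ`.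
  obtain ⟨a, ha, ha1, ha2⟩ := exists_last_eq Sc Sm pi_pos.le
  obtain ⟨b, hb, hb1, hb2⟩ := exists_first_eq Sc Sm pi_pos.le
  have hab : a < b := by
    by_contra! hcon
    have := Sm hcon
    linarith
  have hTab := Tm hab.le
  have hTa := Tm ha.1
  have hTb := Tm hb.2
  have hM := TS π
  by_cases hI : coprim ρ b = coprim ρ a
  · left
    exact ⟨a, b, ha.1, hab.le, hb.2, constOn_of_monotone Sm ha1.symm,
      constOn_of_monotone Tm hI.symm, constOn_of_monotone Sm hb1⟩
  right
  -- Test `s` near `a` and `t` near `b`: a total increment of `coprim ρ` strictly between the two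
  -- admissible values would persist on a small rectangle.
  have hW : coprim ρ b - coprim ρ a = π - prim ρ π := by
    by_contra hne
    have p1 : 0 < coprim ρ b - coprim ρ a := sub_pos.2 (lt_of_le_of_ne hTab (Ne.symm hI))
    have p2 : coprim ρ b - coprim ρ a < π - prim ρ π := lt_of_le_of_ne (by linarith) hne
    have ev : ∀ᶠ ε in 𝓝[>] (0 : ℝ), 0 < coprim ρ (b - ε) - coprim ρ (a + ε) := by
      have : Continuous fun ε => coprim ρ (b - ε) - coprim ρ (a + ε) := by fun_prop
      exact nhdsWithin_le_nhds (this.continuousAt.eventually (lt_mem_nhds (by simpa using p1)))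
    have ev2 : ∀ᶠ ε in 𝓝[>] (0 : ℝ), ε < (b - a) / 2 :=
      nhdsWithin_le_nhds (gt_mem_nhds (by linarith))
    obtain ⟨ε, h1, h2, h3⟩ := (ev.and (ev2.and self_mem_nhdsWithin)).exists
    have h3 : 0 < ε := h3
    obtain ⟨s, hs, t, ht, hst⟩ := h.exists_coprim_sub_of_eq heq ha.1 (by linarith : a ≤ a + ε)
      (by linarith : a + ε ≤ b - ε) (by linarith : b - ε ≤ b) hb.2
      (by rw [ha1]; exact ha2 _ (by linarith) (by linarith [hb.2]))
      (by rw [hb1]; exact hb2 _ (by linarith [ha.1]) (by linarith))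
    have := Tm hs.1
    have := Tm hs.2
    have := Tm ht.1
    have := Tm ht.2
    rcases hst with hst | hst <;> linarith
  have a0 : a = 0 := by have := TS a; linarith
  -- `coprim ρ` is zero up to `α` and has its final value from `β` on; mass of `ρ` between them has
  -- to be excluded.
  obtain ⟨α, hα, hα1, hα2⟩ := exists_last_eq Tc Tm pi_pos.le
  obtain ⟨β, hβ, hβ1, hβ2⟩ := exists_first_eq Tc Tm pi_pos.le
  have hMpos : 0 < coprim ρ π := by
    have : 0 < coprim ρ b - coprim ρ a := sub_pos.2 (lt_of_le_of_ne hTab (Ne.symm hI))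
    linarith
  have hαβ : α < β := by
    by_contra! hcon
    have := Tm hcon
    linarith
  have hS : prim ρ α = prim ρ β := by
    by_contra hne
    have hlt : prim ρ α < prim ρ β := lt_of_le_of_ne (Sm hαβ.le) hne
    have ev : ∀ᶠ ε in 𝓝[>] (0 : ℝ), 0 < prim ρ (β - ε) - prim ρ (α + ε) := by
      have : Continuous fun ε => prim ρ (β - ε) - prim ρ (α + ε) := by fun_prop
      exact nhdsWithin_le_nhds (this.continuousAt.eventually
        (lt_mem_nhds (by simpa using hlt)))
    have ev2 : ∀ᶠ ε in 𝓝[>] (0 : ℝ), ε < (β - α) / 2 :=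
      nhdsWithin_le_nhds (gt_mem_nhds (by linarith))
    obtain ⟨ε, h1, h2, h3⟩ := (ev.and (ev2.and self_mem_nhdsWithin)).exists
    have h3 : 0 < ε := h3
    have hTα : 0 < coprim ρ (α + ε) := by
      have := hα2 (α + ε) (by linarith) (by linarith [hβ.2]); linarith
    have hTβ : coprim ρ (β - ε) < coprim ρ π := hβ2 _ (by linarith [hα.1]) (by linarith)
    -- There is mass immediately to the right of `0`. Taking `s ∈ [0, η]` and `t ∈ [α + ε, β - ε]`
    -- keeps the increment of `coprim ρ` strictly between the admissible values.
    have ev3 : ∀ᶠ η in 𝓝[>] (0 : ℝ), coprim ρ η < coprim ρ (α + ε) :=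
      nhdsWithin_le_nhds (Tc.continuousAt.eventually (gt_mem_nhds (by rwa [T0])))
    have ev4 : ∀ᶠ η in 𝓝[>] (0 : ℝ), η < α + ε :=
      nhdsWithin_le_nhds (gt_mem_nhds (by linarith [hα.1]))
    obtain ⟨η, k1, k2, k3⟩ := (ev3.and (ev4.and self_mem_nhdsWithin)).exists
    have k3 : 0 < η := k3
    obtain ⟨s, hs, t, ht, hst⟩ := h.exists_coprim_sub_of_eq heq le_rfl k3.le k2.le
      (by linarith : α + ε ≤ β - ε) (by linarith [hβ.2])
      (ha2 η (by linarith) (by linarith [hβ.2])) (by linarith)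
    have := Tm hs.1
    have := Tm hs.2
    have := Tm ht.1
    have := Tm ht.2
    rcases hst with hst | hst <;> linarith
  exact ⟨α, β, hα.1, hαβ.le, hβ.2, constOn_of_monotone Tm hα1.symm,
    constOn_of_monotone Sm hS, constOn_of_monotone Tm hβ1⟩

end Density

/-! ### Coordinates in the plane -/

abbrev Plane := EuclideanSpace ℝ (Fin 2)

/-- The unit vector with polar angle `θ`. -/
noncomputable def dir (θ : ℝ) : Plane := !₂[cos θ, sin θ]

@[simp] lemma dir_zero (θ : ℝ) : dir θ 0 = cos θ := rfl
@[simp] lemma dir_one (θ : ℝ) : dir θ 1 = sin θ := rfl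

/-- The inner product of `p` with `dir θ`. -/
noncomputable def dirVal (p : Plane) (θ : ℝ) : ℝ := p 0 * cos θ + p 1 * sin θ

lemma dirVal_add (p q : Plane) (θ : ℝ) : dirVal (p + q) θ = dirVal p θ + dirVal q θ := by
  simp [dirVal]; ring

lemma dirVal_sub (p q : Plane) (θ : ℝ) : dirVal (p - q) θ = dirVal p θ - dirVal q θ := by
  simp [dirVal]; ring

lemma dirVal_smul (c : ℝ) (p : Plane) (θ : ℝ) : dirVal (c • p) θ = c * dirVal p θ := by
  simp [dirVal]; ring

lemma dirVal_dir (φ θ : ℝ) : dirVal (dir φ) θ = cos (θ - φ) := by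
  simp [dirVal, cos_sub]; ring

lemma continuous_dirVal : Continuous fun z : Plane × ℝ => dirVal z.1 z.2 := by
  unfold dirVal; fun_prop

lemma continuous_dirVal_left (θ : ℝ) : Continuous fun p : Plane => dirVal p θ := by
  unfold dirVal; fun_prop

lemma dist_sq (p q : Plane) : dist p q ^ 2 = (p 0 - q 0) ^ 2 + (p 1 - q 1) ^ 2 := by
  rw [EuclideanSpace.dist_eq, Real.sq_sqrt (by positivity)]
  simp [Real.dist_eq, sq_abs]

lemma mem_closedBall_iff {p c : Plane} {r : ℝ} (hr : 0 ≤ r) :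
    p ∈ closedBall c r ↔ (p 0 - c 0) ^ 2 + (p 1 - c 1) ^ 2 ≤ r ^ 2 := by
  rw [mem_closedBall, ← dist_sq, pow_le_pow_iff_left₀ dist_nonneg hr (by norm_num)]

lemma mem_sphere_iff {p c : Plane} {r : ℝ} (hr : 0 ≤ r) :
    p ∈ sphere c r ↔ (p 0 - c 0) ^ 2 + (p 1 - c 1) ^ 2 = r ^ 2 := by
  rw [mem_sphere, ← dist_sq, pow_left_inj₀ dist_nonneg hr (by norm_num)]

lemma plane_ext {p q : Plane} (h0 : p 0 = q 0) (h1 : p 1 = q 1) : p = q := by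
  ext i; fin_cases i <;> assumption

lemma exists_polar (a b : ℝ) : ∃ θ, a = sqrt (a ^ 2 + b ^ 2) * cos θ ∧
    b = sqrt (a ^ 2 + b ^ 2) * sin θ := by
  refine ⟨Complex.arg ⟨a, b⟩, ?_, ?_⟩
  · have := Complex.norm_mul_cos_arg ⟨a, b⟩
    rw [Complex.norm_eq_sqrt_sq_add_sq] at this
    exact this.symm
  · have := Complex.norm_mul_sin_arg ⟨a, b⟩
    rw [Complex.norm_eq_sqrt_sq_add_sq] at this
    exact this.symm

lemma exists_dir_of_sphere {p c : Plane} {r : ℝ} (hr : 0 ≤ r) (h : p ∈ sphere c r) :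
    ∃ β, p = c + r • dir β := by
  obtain ⟨β, h0, h1⟩ := exists_polar (p 0 - c 0) (p 1 - c 1)
  rw [(mem_sphere_iff hr).1 h, sqrt_sq hr] at h0 h1
  exact ⟨β, plane_ext (by simp; linarith) (by simp; linarith)⟩

lemma dirVal_le_of_mem_closedBall {p c : Plane} {r : ℝ} (hr : 0 ≤ r) (h : p ∈ closedBall c r)
    (θ : ℝ) : dirVal p θ ≤ dirVal c θ + r := by
  rw [mem_closedBall_iff hr] at h
  have h1 : dirVal (p - c) θ ^ 2 ≤ r ^ 2 := by
    refine le_trans ?_ h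
    simp only [dirVal, PiLp.sub_apply]
    nlinarith [sq_nonneg ((p 0 - c 0) * sin θ - (p 1 - c 1) * cos θ), sin_sq_add_cos_sq θ]
  have := abs_le_of_sq_le_sq' h1 hr
  rw [dirVal_sub] at this
  linarith [this.2]

lemma dirVal_eq_inner (p : Plane) (θ : ℝ) : dirVal p θ = inner ℝ p (dir θ) := by
  simp [dirVal, PiLp.inner_apply, Fin.sum_univ_two]; ring

lemma norm_dir (θ : ℝ) : ‖dir θ‖ = 1 := by
  rw [EuclideanSpace.norm_eq]; simp [Fin.sum_univ_two]

lemma abs_dirVal_le (p : Plane) (θ : ℝ) : |dirVal p θ| ≤ ‖p‖ := by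
  rw [dirVal_eq_inner]
  simpa [norm_dir] using abs_real_inner_le_norm p (dir θ)

/-- Every continuous linear functional on the plane is a multiple of some `dirVal · θ`. -/
lemma exists_dirVal_of_clm (f : Plane →L[ℝ] ℝ) (hf : f ≠ 0) :
    ∃ c > 0, ∃ θ, ∀ p, f p = c * dirVal p θ := by
  set a := f (EuclideanSpace.single 0 1)
  set b := f (EuclideanSpace.single 1 1)
  have hfp : ∀ p : Plane, f p = p 0 * a + p 1 * b := by
    intro p
    have : p = p 0 • EuclideanSpace.single 0 (1 : ℝ) + p 1 • EuclideanSpace.single 1 (1 : ℝ) := by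
      apply plane_ext <;> simp
    conv_lhs => rw [this]
    simp [a, b]
  obtain ⟨θ, h0, h1⟩ := exists_polar a b
  refine ⟨sqrt (a ^ 2 + b ^ 2), ?_, θ, fun p => ?_⟩
  · refine Real.sqrt_pos.2 ?_
    by_contra! hcon
    have ha : a = 0 := by nlinarith [sq_nonneg a, sq_nonneg b]
    have hb : b = 0 := by nlinarith [sq_nonneg a, sq_nonneg b]
    apply hf; ext p; simp [hfp, ha, hb]
  · rw [hfp]; unfold dirVal
    linear_combination p 0 * h0 + p 1 * h1

/-! ### Support points -/

/-- `p` is a point of `K` that is extreme in the direction `θ`. -/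
def IsSupp (K : Set Plane) (p : Plane) (θ : ℝ) : Prop :=
  p ∈ K ∧ ∀ q ∈ K, dirVal q θ ≤ dirVal p θ

lemma IsSupp.mem_frontier {K : Set Plane} {p : Plane} {θ : ℝ} (h : IsSupp K p θ) :
    p ∈ frontier K := by
  refine ⟨subset_closure h.1, fun hi => ?_⟩
  have hc : Continuous fun t : ℝ => p + t • dir θ := by fun_prop
  have : ∀ᶠ t in 𝓝[>] (0 : ℝ), p + t • dir θ ∈ K :=
    nhdsWithin_le_nhds (hc.continuousAt.eventually
      (by simpa using mem_interior_iff_mem_nhds.1 hi))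
  obtain ⟨t, ht, ht0⟩ := (this.and self_mem_nhdsWithin).exists
  have := h.2 _ ht
  rw [dirVal_add, dirVal_smul, dirVal_dir] at this
  have ht0 : 0 < t := ht0
  simp at this
  linarith

lemma IsSupp.of_dirVal_ge {K : Set Plane} {p q : Plane} {θ : ℝ} (h : IsSupp K p θ) (hq : q ∈ K)
    (hpq : dirVal p θ ≤ dirVal q θ) : IsSupp K q θ :=
  ⟨hq, fun z hz => (h.2 z hz).trans hpq⟩

lemma exists_isSupp {K : Set Plane} (hK : IsPlanarConvexBody K) (θ : ℝ) : ∃ p, IsSupp K p θ := by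
  obtain ⟨p, hp, hmax⟩ := hK.isCompact.exists_isMaxOn
    (hK.interior_nonempty.mono interior_subset) (continuous_dirVal_left θ).continuousOn
  exact ⟨p, hp, fun q hq => hmax hq⟩

/-- Midpoint strict convexity of a disc. -/
lemma eq_zero_of_add_sub_mem {m d c : Plane} {r : ℝ} (hr : 0 ≤ r) (hm : m ∈ sphere c r)
    (h1 : m + d ∈ closedBall c r) (h2 : m - d ∈ closedBall c r) : d = 0 := by
  rw [mem_sphere_iff hr] at hm
  rw [mem_closedBall_iff hr] at h1 h2
  simp only [PiLp.add_apply, PiLp.sub_apply] at h1 h2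
  have : d 0 ^ 2 + d 1 ^ 2 ≤ 0 := by nlinarith
  exact plane_ext (by simp; nlinarith [sq_nonneg (d 0), sq_nonneg (d 1)])
    (by simp; nlinarith [sq_nonneg (d 0), sq_nonneg (d 1)])

variable {lam : ℝ} {K : Set Plane}

/-- Two support points would put a segment in the boundary. The barrier disc at its midpoint would
contain points on both sides of the midpoint, which lies on its circle, against strict convexity. -/
lemma isSupp_unique (hlam : 0 < lam) (hK : IsLamConvexBody lam K) {p q : Plane} {θ : ℝ}
    (hp : IsSupp K p θ) (hq : IsSupp K q θ) : p = q := by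
  have hr : 0 ≤ 1 / lam := by positivity
  have hpq : dirVal p θ = dirVal q θ := le_antisymm (hq.2 p hp.1) (hp.2 q hq.1)
  set m := (1 / 2 : ℝ) • p + (1 / 2 : ℝ) • q with hm
  set d := (1 / 2 : ℝ) • q - (1 / 2 : ℝ) • p with hd
  have hseg : ∀ t : ℝ, |t| ≤ 1 → IsSupp K (m + t • d) θ := by
    intro t ht
    have e : m + t • d = ((1 - t) / 2) • p + ((1 + t) / 2) • q := by
      rw [hm, hd]; module
    rw [abs_le] at ht
    rw [e]
    refine hp.of_dirVal_ge (hK.convex hp.1 hq.1 (by linarith) (by linarith) (by ring)) ?_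
    rw [dirVal_add, dirVal_smul, dirVal_smul, hpq]
    apply le_of_eq; ring
  obtain ⟨U, hU, c, hc, hUc⟩ := hK.barrier m (by simpa using (hseg 0 (by simp)).mem_frontier)
  have hcont : Continuous fun t : ℝ => m + t • d := by fun_prop
  have hcont' : Continuous fun t : ℝ => m + (-t) • d := by fun_prop
  have e1 : ∀ᶠ t in 𝓝[>] (0 : ℝ), m + t • d ∈ U :=
    nhdsWithin_le_nhds (hcont.continuousAt.eventually (by simpa using hU))
  have e2 : ∀ᶠ t in 𝓝[>] (0 : ℝ), m + (-t) • d ∈ U :=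
    nhdsWithin_le_nhds (hcont'.continuousAt.eventually (by simpa using hU))
  have e3 : ∀ᶠ t in 𝓝[>] (0 : ℝ), t < 1 := nhdsWithin_le_nhds (gt_mem_nhds one_pos)
  obtain ⟨t, h1, h2, h3, h4⟩ := (e1.and (e2.and (e3.and self_mem_nhdsWithin))).exists
  have h4 : 0 < t := h4
  have k1 := hUc ⟨h1, (hseg t (abs_le.2 ⟨by linarith, h3.le⟩)).mem_frontier⟩
  have k2 := hUc ⟨h2, (hseg (-t) (abs_le.2 ⟨by linarith, by linarith⟩)).mem_frontier⟩
  have := eq_zero_of_add_sub_mem hr hc k1 (by rw [neg_smul] at k2; exact k2)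
  have hd0 : d = 0 := (smul_eq_zero.1 this).resolve_left h4.ne'
  have := sub_eq_zero.1 hd0
  exact (smul_right_injective Plane (by norm_num : (1 / 2 : ℝ) ≠ 0) this).symm

/-- The support point of `K` in direction `θ`. -/
noncomputable def suppPt (K : Set Plane) (θ : ℝ) : Plane := Classical.epsilon fun p => IsSupp K p θ

lemma suppPt_spec (hK : IsPlanarConvexBody K) (θ : ℝ) : IsSupp K (suppPt K θ) θ :=
  Classical.epsilon_spec (exists_isSupp hK θ)

lemma eq_suppPt (hlam : 0 < lam) (hK : IsLamConvexBody lam K) {p : Plane} {θ : ℝ}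
    (hp : IsSupp K p θ) : p = suppPt K θ :=
  isSupp_unique hlam hK hp (suppPt_spec hK.toIsPlanarConvexBody θ)

lemma suppPt_congr {θ φ : ℝ} (hc : cos θ = cos φ) (hs : sin θ = sin φ) :
    suppPt K θ = suppPt K φ := by
  simp only [suppPt, IsSupp, dirVal, hc, hs]

lemma suppPt_periodic (K : Set Plane) : Function.Periodic (suppPt K) (2 * π) := fun θ =>
  suppPt_congr (by simp) (by simp)

/-- By compactness it is enough to identify cluster points: any cluster point is again a support
point, hence unique. -/
lemma continuous_suppPt (hlam : 0 < lam) (hK : IsLamConvexBody lam K) :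
    Continuous (suppPt K) := by
  rw [continuous_iff_continuousAt]
  intro θ
  refine hK.isCompact.tendsto_nhds_of_unique_mapClusterPt
    (Eventually.of_forall fun φ => (suppPt_spec hK.toIsPlanarConvexBody φ).1) ?_
  intro y hy hcl
  refine eq_suppPt hlam hK ⟨hy, fun q hq => ?_⟩
  by_contra! hlt
  have hset : IsOpen {z : Plane × ℝ | dirVal z.1 z.2 < dirVal q z.2} :=
    isOpen_lt continuous_dirVal (by unfold dirVal; fun_prop)
  have hev := hset.mem_nhds (show (y, θ) ∈ _ from hlt)
  rw [nhds_prod_eq, mem_prod_iff] at hev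
  obtain ⟨U, hU, V, hV, hUV⟩ := hev
  obtain ⟨φ, h1, h2⟩ := ((mapClusterPt_iff_frequently.1 hcl U hU).and_eventually hV).exists
  have h3 : dirVal (suppPt K φ) φ < dirVal q φ := hUV (mk_mem_prod h1 h2)
  exact h3.not_ge ((suppPt_spec hK.toIsPlanarConvexBody φ).2 q hq)

lemma dirVal_add_pi (p : Plane) (θ : ℝ) : dirVal p (θ + π) = - dirVal p θ := by
  simp [dirVal]; ring

lemma dirVal_periodic (p : Plane) : Function.Periodic (dirVal p) (2 * π) := fun θ => by
  simp [dirVal]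

/-- For `a ≤ φ ≤ b < a + π` the coefficients are nonnegative, so inequalities in directions `a` and
`b` pass to every direction between them. -/
lemma dirVal_cone (p : Plane) (a b φ : ℝ) :
    dirVal p φ * sin (b - a) = dirVal p a * sin (b - φ) + dirVal p b * sin (φ - a) := by
  simp only [dirVal, sin_sub]
  ring

lemma exists_isSupp_of_mem_frontier (hK : IsPlanarConvexBody K) {p : Plane}
    (hp : p ∈ frontier K) : ∃ θ, IsSupp K p θ := by
  obtain ⟨f, hf⟩ := geometric_hahn_banach_open_point hK.convex.interior isOpen_interior hp.2
  have hf0 : f ≠ 0 := by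
    rintro rfl
    obtain ⟨z, hz⟩ := hK.interior_nonempty
    simpa using hf z hz
  obtain ⟨c, hc, θ, hθ⟩ := exists_dirVal_of_clm f hf0
  have hcl : IsClosed K := hK.isCompact.isClosed
  refine ⟨θ, hcl.closure_eq ▸ hp.1, fun q hq => ?_⟩
  have hq' : q ∈ closure (interior K) := by
    rw [hK.convex.closure_interior_eq_closure_of_nonempty_interior hK.interior_nonempty]
    exact subset_closure hq
  have hle : interior K ⊆ {z | f z ≤ f p} := fun z hz => (hf z hz).le
  have := closure_minimal hle (isClosed_le f.continuous continuous_const) hq'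
  simp only [mem_ofPred_eq, hθ] at this
  exact le_of_mul_le_mul_left this hc

lemma mem_of_forall_dirVal_le (hK : IsPlanarConvexBody K) {z : Plane}
    (hz : ∀ θ, dirVal z θ ≤ dirVal (suppPt K θ) θ) : z ∈ K := by
  by_contra hcon
  obtain ⟨f, u, hf, hu⟩ := geometric_hahn_banach_closed_point hK.convex hK.isCompact.isClosed hcon
  have hf0 : f ≠ 0 := by
    rintro rfl
    obtain ⟨y, hy⟩ := hK.interior_nonempty
    have := hf y (interior_subset hy)
    simp at this hu
    linarith
  obtain ⟨c, hc, θ, hθ⟩ := exists_dirVal_of_clm f hf0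
  have h1 := hf _ (suppPt_spec hK θ).1
  rw [hθ] at h1 hu
  have := mul_le_mul_of_nonneg_left (hz θ) hc.le
  linarith

lemma not_isSupp_antipodal (hK : IsPlanarConvexBody K) {p : Plane} {θ : ℝ}
    (h1 : IsSupp K p θ) (h2 : IsSupp K p (θ + π)) : False := by
  obtain ⟨z, hz⟩ := hK.interior_nonempty
  have hz' := interior_subset hz
  have h3 := h2.2 z hz'
  rw [dirVal_add_pi, dirVal_add_pi] at h3
  exact (h1.of_dirVal_ge hz' (by linarith)).mem_frontier.2 hz

lemma IsSupp.cone {p : Plane} {a b φ : ℝ} (ha : IsSupp K p a) (hb : IsSupp K p b)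
    (h1 : a ≤ φ) (h2 : φ ≤ b) (hab : b - a < π) : IsSupp K p φ := by
  refine ⟨ha.1, fun q hq => ?_⟩
  rcases eq_or_lt_of_le (h1.trans h2) with rfl | hlt
  · obtain rfl := le_antisymm h1 h2
    exact ha.2 q hq
  have hs : 0 < sin (b - a) := sin_pos_of_pos_of_lt_pi (by linarith) hab
  have s1 : 0 ≤ sin (b - φ) := sin_nonneg_of_nonneg_of_le_pi (by linarith) (by linarith)
  have s2 : 0 ≤ sin (φ - a) := sin_nonneg_of_nonneg_of_le_pi (by linarith) (by linarith)
  refine le_of_mul_le_mul_right ?_ hs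
  rw [dirVal_cone q a b, dirVal_cone p a b]
  exact add_le_add (mul_le_mul_of_nonneg_right (ha.2 q hq) s1)
    (mul_le_mul_of_nonneg_right (hb.2 q hq) s2)

lemma mem_of_preconnected_of_disjoint_frontier {X : Type*} [TopologicalSpace X] {s t : Set X}
    (hs : IsPreconnected s) (hd : Disjoint s (frontier t)) (hne : (s ∩ interior t).Nonempty) :
    s ⊆ interior t := by
  refine hs.subset_left_of_subset_union isOpen_interior
    (isClosed_closure (s := t)).isOpen_compl ?_ ?_ hne
  · exact disjoint_compl_right_iff_subset.2 (interior_subset.trans subset_closure)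
  · intro x hx
    by_cases h : x ∈ interior t
    · exact Or.inl h
    · exact Or.inr fun hc => hd.le_bot ⟨hx, hc, h⟩

/-- The outer normal of a barrier disc is an outer normal of the body. -/
lemma isSupp_of_barrier (hlam : 0 < lam) (hK : IsLamConvexBody lam K) {p c : Plane} {β : ℝ}
    (hp : p ∈ frontier K) {U : Set Plane} (hU : U ∈ 𝓝 p) (hpc : p = c + (1 / lam) • dir β)
    (hUc : U ∩ frontier K ⊆ closedBall c (1 / lam)) : IsSupp K p β := by
  have hr : 0 < 1 / lam := by positivity
  set r := 1 / lam
  have hcl : IsClosed K := hK.isCompact.isClosed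
  have hpK : p ∈ K := hcl.closure_eq ▸ hp.1
  refine ⟨hpK, fun q hq => ?_⟩
  by_contra! hlt
  obtain ⟨ε, hε, hball⟩ := Metric.mem_nhds_iff.1 hU
  -- `H` is a half ball beyond the tangent line of the barrier disc, so it misses the frontier; a
  -- point of `K` in it forces all of `H` into the interior.
  set H : Set Plane := ball p ε ∩ {z | dirVal p β < dirVal z β} with hH
  have hpβ : dirVal p β = dirVal c β + r := by
    rw [hpc, dirVal_add, dirVal_smul, dirVal_dir]; simp
  have hHd : Disjoint H (frontier K) := by
    rw [Set.disjoint_left]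
    rintro z ⟨hz1, hz2⟩ hz3
    have := dirVal_le_of_mem_closedBall hr.le (hUc ⟨hball hz1, hz3⟩) β
    have hz2 : dirVal p β < dirVal z β := hz2
    linarith
  have hHc : Convex ℝ H := by
    refine (convex_ball p ε).inter ?_
    simp_rw [dirVal_eq_inner _ β, real_inner_comm (dir β)]
    exact convex_halfSpace_gt (innerSL ℝ (dir β)).toLinearMap.isLinear _
  have hcont : Continuous fun t : ℝ => p + t • (q - p) := by fun_prop
  have e1 : ∀ᶠ t in 𝓝[>] (0 : ℝ), p + t • (q - p) ∈ ball p ε :=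
    nhdsWithin_le_nhds (hcont.continuousAt.eventually 
      (by simp only [zero_smul, add_zero]; exact ball_mem_nhds p hε))
  have e3 : ∀ᶠ t in 𝓝[>] (0 : ℝ), t < 1 := nhdsWithin_le_nhds (gt_mem_nhds one_pos)
  obtain ⟨t, h1, h3, h4⟩ := (e1.and (e3.and self_mem_nhdsWithin)).exists
  have h4 : 0 < t := h4
  have hzH : p + t • (q - p) ∈ H := by
    refine ⟨h1, ?_⟩
    simp only [mem_ofPred_eq, dirVal_add, dirVal_smul, dirVal_sub]
    nlinarith
  have hzK : p + t • (q - p) ∈ K := by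
    have e : p + t • (q - p) = (1 - t) • p + t • q := by module
    rw [e]
    exact hK.convex hpK hq (by linarith) h4.le (by ring)
  have hzi : p + t • (q - p) ∈ interior K := by
    by_contra hni
    exact hHd.le_bot ⟨hzH, subset_closure hzK, hni⟩
  have hHK : H ⊆ interior K :=
    mem_of_preconnected_of_disjoint_frontier hHc.isPreconnected hHd ⟨_, hzH, hzi⟩
  -- Points of the tangent line near `p`, other than `p`, are limits of `H` but lie outside the
  -- disc, so they are interior. Then `p` is the midpoint of two interior points.
  have hside : ∀ s : ℝ, s ≠ 0 → |s| < ε → p + s • dir (β + π / 2) ∈ interior K := by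
    intro s hs hsε
    set z := p + s • dir (β + π / 2) with hz
    have hzb : z ∈ ball p ε := by
      rw [mem_ball, dist_eq_norm, hz, add_sub_cancel_left, norm_smul, norm_dir]; simpa using hsε
    have hzv : dirVal z β = dirVal p β := by
      rw [hz, dirVal_add, dirVal_smul, dirVal_dir]
      simp
    have hzcl : z ∈ closure K := by
      have hc2 : Continuous fun t : ℝ => z + t • dir β := by fun_prop
      have ev : ∀ᶠ t in 𝓝[>] (0 : ℝ), z + t • dir β ∈ K := by
        have : ∀ᶠ t in 𝓝[>] (0 : ℝ), z + t • dir β ∈ ball p ε :=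
          nhdsWithin_le_nhds (hc2.continuousAt.eventually
            (by simp only [zero_smul, add_zero]; exact isOpen_ball.mem_nhds hzb))
        filter_upwards [this, self_mem_nhdsWithin] with t ht1 ht2
        refine interior_subset (hHK ⟨ht1, ?_⟩)
        simp only [mem_ofPred_eq, dirVal_add, dirVal_smul, dirVal_dir, hzv, sub_self, cos_zero,
          mul_one]
        have ht2 : 0 < t := ht2
        linarith
      have ht : Tendsto (fun t : ℝ => z + t • dir β) (𝓝[>] 0) (𝓝 z) := by
        have := hc2.tendsto 0
        simp only [zero_smul, add_zero] at this
        exact this.mono_left nhdsWithin_le_nhds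
      exact mem_closure_of_tendsto ht ev
    by_contra hni
    have hzc := hUc ⟨hball hzb, hzcl, hni⟩
    rw [mem_closedBall_iff hr.le, hz, hpc] at hzc
    simp [cos_add_pi_div_two, sin_add_pi_div_two] at hzc
    have := sin_sq_add_cos_sq β
    have : 0 < s ^ 2 := by positivity
    nlinarith
  have k1 := hside (ε / 2) (by positivity) (by rw [abs_of_pos (by positivity)]; linarith)
  have k2 := hside (-(ε / 2)) (by simpa using hε.ne') (by
    rw [abs_neg, abs_of_pos (by positivity)]; linarith)
  have := hK.convex.interior k1 k2 (by norm_num : (0 : ℝ) ≤ 1 / 2) (by norm_num : (0 : ℝ) ≤ 1 / 2)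
    (by norm_num)
  apply hp.2
  convert this using 1
  module

/-- The support function. -/
noncomputable def suppFn (K : Set Plane) (θ : ℝ) : ℝ := dirVal (suppPt K θ) θ

/-! ### Differentiability of the support function. -/

lemma dist_dir_le (φ β : ℝ) : ‖dir φ - dir β‖ ≤ |φ - β| := by
  rw [← dist_eq_norm]
  refine abs_le_of_sq_le_sq' ?_ (abs_nonneg _) |>.2
  rw [dist_sq, sq_abs]
  have h1 := one_sub_sq_div_two_le_cos (x := φ - β)
  rw [cos_sub] at h1
  simp only [dir_zero, dir_one]
  nlinarith [sin_sq_add_cos_sq φ, sin_sq_add_cos_sq β]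

lemma suppFn_sub_nonneg (hK : IsPlanarConvexBody K) (φ β : ℝ) :
    0 ≤ suppFn K φ - dirVal (suppPt K β) φ :=
  sub_nonneg.2 ((suppPt_spec hK φ).2 _ (suppPt_spec hK β).1)

/-- Adding the nonnegative defect at `β` turns the left side into the inner product of `suppPt K φ -
suppPt K β` with `dir φ - dir β`; continuity of the support point then makes it `o(φ - β)`. -/
lemma suppFn_sub_le (hK : IsPlanarConvexBody K) (φ β : ℝ) :
    suppFn K φ - dirVal (suppPt K β) φ ≤ ‖suppPt K φ - suppPt K β‖ * |φ - β| := by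
  have h1 := (suppPt_spec hK β).2 _ (suppPt_spec hK φ).1
  have h2 := (real_inner_le_norm (suppPt K φ - suppPt K β) (dir φ - dir β)).trans
    (mul_le_mul_of_nonneg_left (dist_dir_le φ β) (norm_nonneg _))
  rw [inner_sub_right, ← dirVal_eq_inner, ← dirVal_eq_inner, dirVal_sub, dirVal_sub] at h2
  unfold suppFn
  linarith

lemma hasDerivAt_dirVal (p : Plane) (β : ℝ) :
    HasDerivAt (dirVal p) (dirVal p (β + π / 2)) β := by
  have := ((hasDerivAt_cos β).const_mul (p 0)).add ((hasDerivAt_sin β).const_mul (p 1))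
  refine this.congr_deriv ?_
  simp [dirVal, cos_add_pi_div_two, sin_add_pi_div_two]

lemma hasDerivAt_suppFn_sub (hlam : 0 < lam) (hK : IsLamConvexBody lam K) (β : ℝ) :
    HasDerivAt (fun φ => suppFn K φ - dirVal (suppPt K β) φ) 0 β := by
  have hb := hK.toIsPlanarConvexBody
  rw [hasDerivAt_iff_isLittleO]
  have h0 : suppFn K β - dirVal (suppPt K β) β = 0 := by simp [suppFn]
  simp only [h0, sub_zero, smul_zero]
  have ht : Tendsto (fun φ => ‖suppPt K φ - suppPt K β‖) (𝓝 β) (𝓝 0) := by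
    have : Continuous fun φ => ‖suppPt K φ - suppPt K β‖ :=
      ((continuous_suppPt hlam hK).sub continuous_const).norm
    simpa using this.tendsto β
  have h1 := ((Asymptotics.isLittleO_one_iff ℝ).2 ht).mul_isBigO
    (Asymptotics.isBigO_refl (fun φ : ℝ => φ - β) (𝓝 β))
  simp only [one_mul] at h1
  refine Asymptotics.IsBigO.trans_isLittleO (Asymptotics.IsBigO.of_bound 1 ?_) h1
  filter_upwards with φ
  rw [norm_mul, one_mul, Real.norm_eq_abs, Real.norm_eq_abs, Real.norm_eq_abs,
    abs_of_nonneg (suppFn_sub_nonneg hb φ β), abs_of_nonneg (norm_nonneg _)]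
  exact suppFn_sub_le hb φ β

lemma hasDerivAt_suppFn (hlam : 0 < lam) (hK : IsLamConvexBody lam K) (β : ℝ) :
    HasDerivAt (suppFn K) (dirVal (suppPt K β) (β + π / 2)) β := by
  have := (hasDerivAt_suppFn_sub hlam hK β).add (hasDerivAt_dirVal (suppPt K β) β)
  rw [zero_add] at this
  refine this.congr_of_eventuallyEq (Eventually.of_forall fun φ => ?_)
  simp

lemma continuous_suppFn (hlam : 0 < lam) (hK : IsLamConvexBody lam K) : Continuous (suppFn K) :=
  continuous_iff_continuousAt.2 fun β => (hasDerivAt_suppFn hlam hK β).continuousAt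

lemma dirVal_of_components {v : Plane} {β R : ℝ} (h1 : dirVal v β = R)
    (h2 : dirVal v (β + π / 2) = 0) (φ : ℝ) : dirVal v φ = R * cos (φ - β) := by
  have := dirVal_cone v β (β + π / 2) φ
  rw [h1, h2] at this
  simp at this
  rw [this, show β + π / 2 - φ = π / 2 - (φ - β) by ring, sin_pi_div_two_sub]

/-! ### Comparison of the support function with discs. -/

lemma cos_lt_one_of {x : ℝ} (h0 : x ≠ 0) (h1 : |x| ≤ π) : cos x < 1 := by
  rw [← cos_abs, ← cos_zero]
  exact cos_lt_cos_of_nonneg_of_le_pi le_rfl h1 (abs_pos.2 h0)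

lemma exists_reduced_angle (β β' : ℝ) : ∃ δ, -π < δ ∧ δ ≤ π ∧ cos (β + δ) = cos β' ∧
    sin (β + δ) = sin β' := by
  have hmem := toIocMod_mem_Ioc two_pi_pos (-π) (β' - β)
  have hself := self_sub_toIocDiv_zsmul two_pi_pos (-π) (β' - β)
  set δ := toIocMod two_pi_pos (-π) (β' - β)
  have e : β + δ = β' - (toIocDiv two_pi_pos (-π) (β' - β)) * (2 * π) := by
    simp only [zsmul_eq_mul] at hself
    linarith
  refine ⟨δ, hmem.1, by linarith [hmem.2], ?_, ?_⟩
  · rw [e, cos_sub_int_mul_two_pi]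
  · rw [e, sin_sub_int_mul_two_pi]

lemma isSupp_congr {p : Plane} {θ φ : ℝ} (hc : cos θ = cos φ) (hs : sin θ = sin φ) :
    IsSupp K p θ ↔ IsSupp K p φ := by
  simp only [IsSupp, dirVal, hc, hs]

/-- No disc of radius larger than `1 / lam` touches the support function from below. -/
lemma not_touch_from_below (hlam : 0 < lam) (hK : IsLamConvexBody lam K) {β R : ℝ} {c' : Plane}
    (hR : 1 / lam < R) (heq : suppFn K β = dirVal c' β + R)
    (hev : ∀ᶠ φ in 𝓝 β, dirVal c' φ + R ≤ suppFn K φ) : False := by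
  have hb := hK.toIsPlanarConvexBody
  have hr : 0 < 1 / lam := by positivity
  set p := suppPt K β with hp
  have hsp : IsSupp K p β := suppPt_spec hb β
  -- The first-order condition at the contact gives `p = c' + R • dir β`.
  have hd : dirVal (p - c') (β + π / 2) = 0 := by
    have h1 := ((hasDerivAt_suppFn hlam hK β).sub (hasDerivAt_dirVal c' β)).sub_const R
    have hmin : IsLocalMin (fun φ => suppFn K φ - dirVal c' φ - R) β := by
      filter_upwards [hev] with φ hφ
      linarith
    rw [dirVal_sub]
    exact hmin.hasDerivAt_eq_zero h1
  have hv : dirVal (p - c') β = R := by rw [dirVal_sub]; unfold suppFn at heq; linarith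
  have hform := dirVal_of_components hv hd
  obtain ⟨U, hU, c, hc, hUc⟩ := hK.barrier p hsp.mem_frontier
  obtain ⟨β', hβ'⟩ := exists_dir_of_sphere hr.le hc
  have hsβ' := isSupp_of_barrier hlam hK hsp.mem_frontier hU hβ' hUc
  obtain ⟨δ, hδ1, hδ2, hcos, hsin⟩ := exists_reduced_angle β β'
  rw [← isSupp_congr hcos hsin] at hsβ'
  have hδπ : δ < π := lt_of_le_of_ne hδ2 fun h => not_isSupp_antipodal hb hsp (h ▸ hsβ')
  have htend : ∀ σ : ℝ, Tendsto (fun τ : ℝ => β + τ * σ) (𝓝[>] 0) (𝓝 β) := fun σ => by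
    have : Continuous fun τ : ℝ => β + τ * σ := by fun_prop
    have := this.tendsto 0
    simp only [zero_mul, add_zero] at this
    exact this.mono_left nhdsWithin_le_nhds
  have hlt1 : ∀ᶠ t in 𝓝[>] (0 : ℝ), t < 1 := nhdsWithin_le_nhds (gt_mem_nhds one_pos)
  -- If the barrier disc has normal `β`, it contains the nearby boundary points, and its radius is
  -- smaller than `R`. Otherwise `p` is a corner, the support function near `β` on one side is that
  -- of the point `p`, and the disc of radius `R` exceeds it.
  rcases eq_or_ne δ 0 with rfl | hδ0
  · have hcb : c = p - (1 / lam) • dir β := by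
      have : dir β' = dir β := plane_ext (by simpa using hcos.symm) (by simpa using hsin.symm)
      rw [hβ', this]; simp
    have hxU : ∀ᶠ φ in 𝓝 β, suppPt K φ ∈ U := (continuous_suppPt hlam hK).continuousAt.eventually hU
    obtain ⟨τ, h1, h2, h3, h4⟩ := (((htend 1).eventually hev).and
      (((htend 1).eventually hxU).and (hlt1.and self_mem_nhdsWithin))).exists
    have h4 : 0 < τ := h4
    have h5 := dirVal_le_of_mem_closedBall hr.le
      (hUc ⟨h2, (suppPt_spec hb (β + τ * 1)).mem_frontier⟩) (β + τ * 1)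
    have h6 := hform (β + τ * 1)
    rw [hcb, dirVal_sub, dirVal_smul, dirVal_dir] at h5
    rw [dirVal_sub] at h6
    unfold suppFn at h1
    have : cos (β + τ * 1 - β) < 1 := cos_lt_one_of (by simpa using h4.ne')
      (by rw [abs_of_pos (by linarith)]; linarith [pi_gt_three])
    nlinarith
  · obtain ⟨τ, h1, h3, h4⟩ := (((htend δ).eventually hev).and (hlt1.and self_mem_nhdsWithin)).exists
    have h4 : 0 < τ := h4
    have hs : IsSupp K p (β + τ * δ) := by
      rcases lt_or_gt_of_ne hδ0 with hneg | hpos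
      · exact hsβ'.cone hsp (by nlinarith) (by nlinarith) (by linarith)
      · exact hsp.cone hsβ' (by nlinarith) (by nlinarith) (by linarith)
    have h6 := hform (β + τ * δ)
    rw [dirVal_sub] at h6
    unfold suppFn at h1
    rw [← eq_suppPt hlam hK hs] at h1
    have : cos (β + τ * δ - β) < 1 := cos_lt_one_of
      (by rw [add_sub_cancel_left]; exact mul_ne_zero h4.ne' hδ0)
      (by
        rw [add_sub_cancel_left, abs_mul, abs_of_pos h4]
        have : |δ| ≤ π := abs_le.2 ⟨hδ1.le, hδ2⟩
        nlinarith [abs_nonneg δ])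
    nlinarith

/-- The body lies locally, as seen by its support function, in the disc of radius `1 / lam`
tangent at any support point. -/
lemma suppFn_le_disc (hlam : 0 < lam) (hK : IsLamConvexBody lam K) {a s δ : ℝ}
    (hs : s = 1 ∨ s = -1) (h0 : 0 ≤ δ) (hδ : δ < π) :
    suppFn K (a + s * δ) ≤ dirVal (suppPt K a) (a + s * δ) + 1 / lam * (1 - cos δ) := by
  rcases h0.eq_or_lt with rfl | h0
  · simp [suppFn]
  by_contra! hlt
  set m := suppFn K (a + s * δ) - (dirVal (suppPt K a) (a + s * δ) + 1 / lam * (1 - cos δ)) with hm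
  have hm0 : 0 < m := sub_pos.2 hlt
  -- Quarters suffice because `1 - cos δ ≤ 2` and `sin δ ≤ 1`, so `f δ ≥ m / 4`. The `κ` term gives
  -- `f` a negative slope at `0`, so `f` dips below zero before `δ`.
  set R := 1 / lam + m / 4 with hR
  set κ := m / 4 with hκ
  set f : ℝ → ℝ := fun τ => suppFn K (a + s * τ) - dirVal (suppPt K a) (a + s * τ)
    - R * (1 - cos τ) - κ * sin τ with hf
  have f0 : f 0 = 0 := by simp [hf, suppFn]
  have fδ : 0 < f δ := by
    have h1 := neg_one_le_cos δ
    have h2 := sin_le_one δ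
    simp only [hf]
    nlinarith
  have fc : Continuous f := by
    have := continuous_suppFn hlam hK
    have h2 := continuous_dirVal.comp (by fun_prop : Continuous fun τ : ℝ => (suppPt K a, a + s * τ))
    simp only [Function.comp_def] at h2
    fun_prop
  have fd : HasDerivAt f (-κ) 0 := by
    have h1 : HasDerivAt (fun τ : ℝ => a + s * τ) s 0 := by
      simpa using ((hasDerivAt_id (0 : ℝ)).const_mul s).const_add a
    have h2 : HasDerivAt (fun φ => suppFn K φ - dirVal (suppPt K a) φ) 0 (a + s * 0) := by
      simpa using hasDerivAt_suppFn_sub hlam hK a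
    have h3 := h2.comp (0 : ℝ) h1
    have h4 := (h3.sub (((hasDerivAt_cos 0).const_sub 1).const_mul R)).sub
      ((hasDerivAt_sin 0).const_mul κ)
    refine h4.congr_deriv ?_
    simp
  obtain ⟨τ₁, hτ₁, hτδ, hτ0⟩ : ∃ τ, f τ < 0 ∧ τ < δ ∧ 0 < τ := by
    have h1 := (hasDerivAt_iff_tendsto_slope.1 fd).eventually
      (gt_mem_nhds (show -κ < 0 by rw [hκ]; linarith))
    have h2 : ∀ᶠ τ in 𝓝[>] (0 : ℝ), slope f 0 τ < 0 :=
      h1.filter_mono (nhdsWithin_mono _ fun x hx => ne_of_gt hx)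
    have h3 : ∀ᶠ t in 𝓝[>] (0 : ℝ), t < δ := nhdsWithin_le_nhds (gt_mem_nhds h0)
    obtain ⟨τ, k1, k2, k3⟩ := (h2.and (h3.and self_mem_nhdsWithin)).exists
    have k3 : 0 < τ := k3
    refine ⟨τ, ?_, k2, k3⟩
    rw [slope_def_field, f0, sub_zero, sub_zero, div_lt_iff₀ k3, zero_mul] at k1
    exact k1
  -- Dividing by this cosine, positive since `δ < π`, replaces a minimum of `f` by a contact with `μ
  -- * cos (τ - δ / 2)`, the support function of a point. The minimum is negative, hence interior.
  have hcos : ∀ τ ∈ Icc 0 δ, 0 < cos (τ - δ / 2) := fun τ hτ =>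
    cos_pos_of_mem_Ioo ⟨by linarith [hτ.1], by linarith [hτ.2]⟩
  obtain ⟨τ', hτ', hmin⟩ := isCompact_Icc.exists_isMinOn (s := Icc 0 δ)
    ⟨0, left_mem_Icc.2 h0.le⟩ (f := fun τ => f τ / cos (τ - δ / 2))
    (fc.continuousOn.div (by fun_prop) fun τ hτ => (hcos τ hτ).ne')
  set μ := f τ' / cos (τ' - δ / 2) with hμ
  have hμ0 : μ < 0 := by
    have h1 : μ ≤ f τ₁ / cos (τ₁ - δ / 2) := isMinOn_iff.1 hmin τ₁ ⟨hτ0.le, hτδ.le⟩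
    exact h1.trans_lt (div_neg_of_neg_of_pos hτ₁ (hcos _ ⟨hτ0.le, hτδ.le⟩))
  have hfμ : f τ' = μ * cos (τ' - δ / 2) := by
    rw [hμ, div_mul_cancel₀ _ (hcos τ' hτ').ne']
  have hge : ∀ τ ∈ Icc 0 δ, μ * cos (τ - δ / 2) ≤ f τ := fun τ hτ =>
    (le_div_iff₀ (hcos τ hτ)).1 (isMinOn_iff.1 hmin τ hτ)
  have hτ'0 : 0 < τ' := by
    refine lt_of_le_of_ne hτ'.1 fun h => ?_
    rw [← h, f0] at hfμ
    have := hcos 0 (left_mem_Icc.2 h0.le)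
    nlinarith
  have hτ'δ : τ' < δ := by
    refine lt_of_le_of_ne hτ'.2 fun h => ?_
    rw [h] at hfμ
    have := hcos δ (right_mem_Icc.2 h0.le)
    nlinarith
  -- All trigonometric terms are support functions of points, so they combine into one centre; the
  -- contact becomes a contact with a disc of radius `R > 1 / lam`.
  set c' : Plane := suppPt K a - R • dir a + (κ * s) • dir (a + π / 2) + μ • dir (a + s * (δ / 2))
    with hc'
  have hc'v : ∀ τ, dirVal c' (a + s * τ) = dirVal (suppPt K a) (a + s * τ) - R * cos τ + κ * sin τ
      + μ * cos (τ - δ / 2) := by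
    intro τ
    rw [hc', dirVal_add, dirVal_add, dirVal_sub, dirVal_smul, dirVal_smul, dirVal_smul, dirVal_dir,
      dirVal_dir, dirVal_dir]
    have e1 : cos (a + s * τ - a) = cos τ := by rcases hs with rfl | rfl <;> simp
    have e2 : s * cos (a + s * τ - (a + π / 2)) = sin τ := by
      rcases hs with rfl | rfl
      · rw [one_mul, show a + 1 * τ - (a + π / 2) = -(π / 2 - τ) by ring, cos_neg, cos_pi_div_two_sub]
      · rw [show a + -1 * τ - (a + π / 2) = -(π / 2 - (-τ)) by ring, cos_neg, cos_pi_div_two_sub]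
        simp
    have e3 : cos (a + s * τ - (a + s * (δ / 2))) = cos (τ - δ / 2) := by
      rcases hs with rfl | rfl
      · congr 1; ring
      · rw [← cos_neg]; congr 1; ring
    rw [e1, e3]
    linear_combination κ * e2
  refine not_touch_from_below hlam hK (β := a + s * τ') (R := R) (c' := c')
    (by rw [hR]; linarith) ?_ ?_
  · rw [hc'v]
    simp only [hf] at hfμ
    linarith
  · have hss : s * s = 1 := by rcases hs with rfl | rfl <;> norm_num
    have hcont : Continuous fun φ : ℝ => s * (φ - a) := by fun_prop
    have hval : s * (a + s * τ' - a) = τ' := by linear_combination τ' * hss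
    have : ∀ᶠ φ in 𝓝 (a + s * τ'), s * (φ - a) ∈ Ioo 0 δ :=
      hcont.continuousAt.eventually (by
        simp only [hval]; exact Ioo_mem_nhds hτ'0 hτ'δ)
    filter_upwards [this] with φ hφ
    have h1 := hge _ ⟨hφ.1.le, hφ.2.le⟩
    have e : a + s * (s * (φ - a)) = φ := by linear_combination (φ - a) * hss
    have h2 := hc'v (s * (φ - a))
    simp only [hf] at h1
    rw [e] at h1 h2
    linarith

/-! ### Lipschitz bound for the support point. -/

lemma dirVal_add_pi_div_two (p : Plane) (θ : ℝ) :
    dirVal p (θ + π / 2) = p 1 * cos θ - p 0 * sin θ := by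
  simp [dirVal, cos_add_pi_div_two, sin_add_pi_div_two]; ring

lemma norm_sq_eq_dirVal (p : Plane) (θ : ℝ) :
    ‖p‖ ^ 2 = dirVal p θ ^ 2 + dirVal p (θ + π / 2) ^ 2 := by
  rw [EuclideanSpace.real_norm_sq_eq, Fin.sum_univ_two, dirVal_add_pi_div_two, dirVal]
  have := sin_sq_add_cos_sq θ
  linear_combination (-(p 0 ^ 2 + p 1 ^ 2)) * this

lemma dirVal_suppPt_sub_nonpos (hK : IsPlanarConvexBody K) (φ θ : ℝ) :
    dirVal (suppPt K φ - suppPt K θ) θ ≤ 0 := by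
  rw [dirVal_sub]
  have := (suppPt_spec hK θ).2 _ (suppPt_spec hK φ).1
  linarith

/-- The disc comparison from each end of the chord bounds its components along the two normals;
`dirVal_cone` converts these into the tangential component after division by `sin δ`. -/
lemma chord_bounds (hlam : 0 < lam) (hK : IsLamConvexBody lam K) {a δ : ℝ}
    (h0 : 0 ≤ δ) (hδ : δ ≤ π / 2) :
    -(1 / lam * (1 - cos δ)) ≤ dirVal (suppPt K (a + δ) - suppPt K a) a ∧
    0 ≤ dirVal (suppPt K (a + δ) - suppPt K a) (a + π / 2) ∧
    dirVal (suppPt K (a + δ) - suppPt K a) (a + π / 2) ≤ 1 / lam * sin δ := by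
  have hb := hK.toIsPlanarConvexBody
  have hpi := pi_pos
  have u1 := suppFn_le_disc hlam hK (a := a) (s := 1) (Or.inl rfl) h0 (by linarith)
  have u2 := suppFn_le_disc hlam hK (a := a + δ) (s := -1) (Or.inr rfl) h0 (by linarith)
  rw [one_mul] at u1
  rw [show a + δ + -1 * δ = a by ring] at u2
  have l1 := dirVal_suppPt_sub_nonpos hb a (a + δ)
  have l2 := dirVal_suppPt_sub_nonpos hb (a + δ) a
  have hcone := dirVal_cone (suppPt K (a + δ) - suppPt K a) a (a + π / 2) (a + δ)
  rw [show a + π / 2 - a = π / 2 by ring, show a + π / 2 - (a + δ) = π / 2 - δ by ring,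
    show a + δ - a = δ by ring, sin_pi_div_two, sin_pi_div_two_sub, mul_one] at hcone
  set d := suppPt K (a + δ) - suppPt K a with hd
  have e1 : dirVal d (a + δ) = suppFn K (a + δ) - dirVal (suppPt K a) (a + δ) := by
    rw [hd, dirVal_sub, suppFn]
  have e2 : dirVal d a = dirVal (suppPt K (a + δ)) a - suppFn K a := by
    rw [hd, dirVal_sub, suppFn]
  have e3 : dirVal (suppPt K a - suppPt K (a + δ)) (a + δ) = - dirVal d (a + δ) := by
    rw [hd, dirVal_sub, dirVal_sub]; ring
  have hc : 0 ≤ cos δ := cos_nonneg_of_mem_Icc ⟨by linarith, hδ⟩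
  rw [e3] at l1
  refine ⟨by linarith, ?_⟩
  rcases h0.eq_or_lt with h | h
  · have : d = 0 := by rw [hd, ← h]; simp
    rw [this, ← h]; simp [dirVal]
  have hs : 0 < sin δ := sin_pos_of_pos_of_lt_pi h (by linarith)
  constructor
  · refine nonneg_of_mul_nonneg_left ?_ hs
    nlinarith
  · refine le_of_mul_le_mul_right ?_ hs
    have : sin δ * sin δ = (1 - cos δ) * (1 + cos δ) := by
      linear_combination sin_sq_add_cos_sq δ
    have h5 : -dirVal d a * cos δ ≤ 1 / lam * (1 - cos δ) * cos δ :=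
      mul_le_mul_of_nonneg_right (by linarith) hc
    rw [mul_assoc (1 / lam) (sin δ), this]
    linarith

lemma lipschitzWith_of_local {X : Type*} [PseudoMetricSpace X] {f : ℝ → X} {C : NNReal} {η : ℝ}
    (hη : 0 < η) (h : ∀ a δ, 0 ≤ δ → δ ≤ η → dist (f a) (f (a + δ)) ≤ C * δ) :
    LipschitzWith C f := by
  apply LipschitzWith.of_dist_le_mul
  intro a b
  wlog hab : a ≤ b generalizing a b
  · rw [dist_comm, dist_comm a]; exact this b a (le_of_not_ge hab)
  obtain ⟨n, hn⟩ := exists_nat_gt ((b - a) / η)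
  have hn0 : (0 : ℝ) < n := lt_of_le_of_lt (div_nonneg (sub_nonneg.2 hab) hη.le) hn
  set δ := (b - a) / n with hδ
  have hδ0 : 0 ≤ δ := div_nonneg (sub_nonneg.2 hab) hn0.le
  have hδη : δ ≤ η := by
    rw [hδ, div_le_iff₀ hn0]
    rw [div_lt_iff₀ hη] at hn
    linarith
  have h1 := dist_le_range_sum_dist (fun i : ℕ => f (a + i * δ)) n
  have h2 : ∀ i ∈ Finset.range n, dist (f (a + i * δ)) (f (a + (i + 1 : ℕ) * δ)) ≤ C * δ := by
    intro i _
    have := h (a + i * δ) δ hδ0 hδη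
    convert this using 3
    push_cast; ring
  have h3 := h1.trans (Finset.sum_le_sum h2)
  have e : a + n * δ = b := by rw [hδ]; field_simp; ring
  simp only [Nat.cast_zero, zero_mul, add_zero, e, Finset.sum_const, Finset.card_range,
    nsmul_eq_mul] at h3
  rw [dist_comm a b, Real.dist_eq, abs_of_nonneg (sub_nonneg.2 hab)]
  calc _ ≤ _ := h3
    _ = C * (b - a) := by rw [hδ]; field_simp

/-- The chord is no longer than that of a circle of radius `1 / lam`, by `(1 - cos δ) ^ 2 + sin δ ^
2 = 2 * (1 - cos δ) ≤ δ ^ 2`. -/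
lemma lipschitzWith_suppPt (hlam : 0 < lam) (hK : IsLamConvexBody lam K) :
    LipschitzWith (1 / lam).toNNReal (suppPt K) := by
  have hr : 0 < 1 / lam := by positivity
  refine lipschitzWith_of_local (η := π / 2) (by positivity) fun a δ h0 hδ => ?_
  rw [Real.coe_toNNReal _ hr.le, dist_comm, dist_eq_norm]
  obtain ⟨h1, h2, h3⟩ := chord_bounds hlam hK (a := a) h0 hδ
  have h4 := dirVal_suppPt_sub_nonpos hK.toIsPlanarConvexBody (a + δ) a
  refine abs_le_of_sq_le_sq' ?_ (by positivity) |>.2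
  rw [norm_sq_eq_dirVal _ a]
  set u := dirVal (suppPt K (a + δ) - suppPt K a) a
  set v := dirVal (suppPt K (a + δ) - suppPt K a) (a + π / 2)
  have k1 : u ^ 2 ≤ (1 / lam * (1 - cos δ)) ^ 2 := by
    rw [← neg_sq]; exact pow_le_pow_left₀ (by linarith) (by linarith) 2
  have k2 : v ^ 2 ≤ (1 / lam * sin δ) ^ 2 := pow_le_pow_left₀ h2 h3 2
  have k3 := one_sub_sq_div_two_le_cos (x := δ)
  have k4 : (1 / lam * (1 - cos δ)) ^ 2 + (1 / lam * sin δ) ^ 2 = (1 / lam) ^ 2 * (2 * (1 - cos δ)) := by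
    linear_combination (1 / lam) ^ 2 * sin_sq_add_cos_sq δ
  have k5 : (1 / lam) ^ 2 * (2 * (1 - cos δ)) ≤ (1 / lam) ^ 2 * δ ^ 2 :=
    mul_le_mul_of_nonneg_left (by linarith) (by positivity)
  rw [mul_pow]
  linarith

/-! ### The curvature density of the body. -/

/-- Coordinates of the support point. -/
noncomputable def suppX (K : Set Plane) (θ : ℝ) : ℝ := suppPt K θ 0
noncomputable def suppY (K : Set Plane) (θ : ℝ) : ℝ := suppPt K θ 1

lemma lipschitzWith_coord (i : Fin 2) : LipschitzWith 1 fun p : Plane => p i := by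
  apply LipschitzWith.of_dist_le_mul
  intro p q
  rw [dist_eq_norm, dist_eq_norm, NNReal.coe_one, one_mul]
  exact PiLp.norm_apply_le (p - q) i

lemma lipschitzWith_suppX (hlam : 0 < lam) (hK : IsLamConvexBody lam K) :
    LipschitzWith (1 / lam).toNNReal (suppX K) := by
  have := (lipschitzWith_coord 0).comp (lipschitzWith_suppPt hlam hK)
  rwa [one_mul] at this

lemma lipschitzWith_suppY (hlam : 0 < lam) (hK : IsLamConvexBody lam K) :
    LipschitzWith (1 / lam).toNNReal (suppY K) := by
  have := (lipschitzWith_coord 1).comp (lipschitzWith_suppPt hlam hK)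
  rwa [one_mul] at this

/-- The radius of curvature as a function of the normal angle, in units of `1 / lam`, clamped to
`[0, 1]`. -/
noncomputable def dens (lam : ℝ) (K : Set Plane) (θ : ℝ) : ℝ :=
  max 0 (min 1 (lam * (deriv (suppY K) θ * cos θ - deriv (suppX K) θ * sin θ)))

lemma density_dens (lam : ℝ) (K : Set Plane) : Density (dens lam K) where
  meas := by
    unfold dens
    have h1 := measurable_deriv (suppX K)
    have h2 := measurable_deriv (suppY K)
    fun_prop
  nonneg t := le_max_left _ _
  le_one t := max_le zero_le_one (min_le_left _ _)

lemma deriv_periodic {f : ℝ → ℝ} {c : ℝ} (hf : Function.Periodic f c) :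
    Function.Periodic (deriv f) c := fun t => by
  rw [← deriv_comp_add_const]
  congr 1
  exact funext hf

lemma dens_periodic (lam : ℝ) (K : Set Plane) : Function.Periodic (dens lam K) (2 * π) := by
  intro t
  have h1 : Function.Periodic (suppX K) (2 * π) := fun t => by
    simp only [suppX, suppPt_periodic K t]
  have h2 : Function.Periodic (suppY K) (2 * π) := fun t => by
    simp only [suppY, suppPt_periodic K t]
  simp only [dens, deriv_periodic h1 t, deriv_periodic h2 t, cos_add_two_pi, sin_add_two_pi]

/-- The component along the normal is maximal at `t`, so its derivative vanishes; `chord_bounds`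
puts the tangential derivative in `[0, 1 / lam]`, so the clamp in `dens` is inactive. -/
lemma ae_hasDerivAt_supp (hlam : 0 < lam) (hK : IsLamConvexBody lam K) :
    ∀ᵐ t, HasDerivAt (suppX K) (-(1 / lam * dens lam K t * sin t)) t ∧
      HasDerivAt (suppY K) (1 / lam * dens lam K t * cos t) t := by
  have hb := hK.toIsPlanarConvexBody
  filter_upwards [(lipschitzWith_suppX hlam hK).ae_differentiableAt_real,
    (lipschitzWith_suppY hlam hK).ae_differentiableAt_real] with t hX hY
  have hX := hX.hasDerivAt
  have hY := hY.hasDerivAt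
  set x' := deriv (suppX K) t with hx'
  set y' := deriv (suppY K) t with hy'
  have hN : HasDerivAt (fun φ => dirVal (suppPt K φ - suppPt K t) t) (x' * cos t + y' * sin t) t :=
    ((hX.sub_const _).mul_const _).add ((hY.sub_const _).mul_const _)
  have hT : HasDerivAt (fun φ => dirVal (suppPt K φ - suppPt K t) (t + π / 2))
      (y' * cos t - x' * sin t) t := by
    simp_rw [dirVal_add_pi_div_two]
    exact ((hY.sub_const _).mul_const _).sub ((hX.sub_const _).mul_const _)
  have hN0 : x' * cos t + y' * sin t = 0 := by
    have hmax : IsLocalMax (fun φ => dirVal (suppPt K φ - suppPt K t) t) t := by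
      filter_upwards with φ
      have := dirVal_suppPt_sub_nonpos hb φ t
      simpa [dirVal] using this
    exact hmax.hasDerivAt_eq_zero hN
  have hT0 : dirVal (suppPt K t - suppPt K t) (t + π / 2) = 0 := by simp [dirVal]
  have hslope := (hasDerivAt_iff_tendsto_slope.1 hT).mono_left
    (nhdsWithin_mono t fun x (hx : x ∈ Ioi t) => ne_of_gt hx)
  have hev : ∀ᶠ φ in 𝓝[>] t, φ ∈ Ioc t (t + π / 2) :=
    Ioc_mem_nhdsGT (by linarith [pi_pos])
  have hnn : 0 ≤ y' * cos t - x' * sin t := by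
    refine ge_of_tendsto hslope ?_
    filter_upwards [hev] with φ hφ
    rw [slope_def_field, hT0, sub_zero]
    have := (chord_bounds hlam hK (a := t) (δ := φ - t) (by linarith [hφ.1])
      (by linarith [hφ.2])).2.1
    rw [add_sub_cancel] at this
    exact div_nonneg this (by linarith [hφ.1])
  have hle : y' * cos t - x' * sin t ≤ 1 / lam := by
    refine le_of_tendsto hslope ?_
    filter_upwards [hev] with φ hφ
    rw [slope_def_field, hT0, sub_zero]
    have := (chord_bounds hlam hK (a := t) (δ := φ - t) (by linarith [hφ.1])
      (by linarith [hφ.2])).2.2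
    rw [add_sub_cancel] at this
    rw [div_le_iff₀ (by linarith [hφ.1])]
    exact this.trans (mul_le_mul_of_nonneg_left (sin_le (by linarith [hφ.1])) (by positivity))
  have hdens : 1 / lam * dens lam K t = y' * cos t - x' * sin t := by
    unfold dens
    rw [min_eq_right, max_eq_right]
    · rw [← hx', ← hy', ← mul_assoc, one_div_mul_cancel hlam.ne', one_mul]
    · positivity
    · rw [← hx', ← hy']
      calc _ ≤ lam * (1 / lam) := by gcongr
        _ = 1 := by field_simp
  have := sin_sq_add_cos_sq t
  constructor
  · refine hX.congr_deriv ?_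
    rw [hdens]
    linear_combination cos t * hN0 - x' * this
  · refine hY.congr_deriv ?_
    rw [hdens]
    linear_combination sin t * hN0 - y' * this

/-! ### Length of the boundary -/

lemma suppX_sub (hlam : 0 < lam) (hK : IsLamConvexBody lam K) (a b : ℝ) :
    suppX K b - suppX K a = ∫ s in a..b, -(1 / lam * dens lam K s * sin s) :=
  (integral_eq_sub_of_absCont (absCont_of_lipschitz (lipschitzWith_suppX hlam hK) a b)
    ((ae_hasDerivAt_supp hlam hK).mono fun _ h => h.1)).symm

lemma suppY_sub (hlam : 0 < lam) (hK : IsLamConvexBody lam K) (a b : ℝ) :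
    suppY K b - suppY K a = ∫ s in a..b, 1 / lam * dens lam K s * cos s :=
  (integral_eq_sub_of_absCont (absCont_of_lipschitz (lipschitzWith_suppY hlam hK) a b)
    ((ae_hasDerivAt_supp hlam hK).mono fun _ h => h.2)).symm

lemma dirVal_suppPt_sub (hlam : 0 < lam) (hK : IsLamConvexBody lam K) (a b φ : ℝ) :
    dirVal (suppPt K b - suppPt K a) φ = 1 / lam * ∫ s in a..b, dens lam K s * sin (φ - s) := by
  have hD := density_dens lam K
  have e : dirVal (suppPt K b - suppPt K a) φ
      = (suppX K b - suppX K a) * cos φ + (suppY K b - suppY K a) * sin φ := rfl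
  rw [e, suppX_sub hlam hK, suppY_sub hlam hK, ← intervalIntegral.integral_mul_const,
    ← intervalIntegral.integral_mul_const, ← intervalIntegral.integral_add,
    ← intervalIntegral.integral_const_mul]
  · congr 1; ext s
    rw [sin_sub]; ring
  · have := (hD.intervalIntegrable_mul (g := fun s => -(1 / lam * sin s * cos φ)) (by fun_prop) a b)
    refine this.congr (fun s _ => ?_)
    ring
  · have := (hD.intervalIntegrable_mul (g := fun s => 1 / lam * cos s * sin φ) (by fun_prop) a b)
    refine this.congr (fun s _ => ?_)
    ring

lemma exists_dirVal_eq_norm (d : Plane) : ∃ φ, dirVal d φ = ‖d‖ := by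
  obtain ⟨φ, h0, h1⟩ := exists_polar (d 0) (d 1)
  refine ⟨φ, ?_⟩
  have : ‖d‖ = sqrt (d 0 ^ 2 + d 1 ^ 2) := by
    rw [EuclideanSpace.norm_eq]; simp [Fin.sum_univ_two]
  rw [this]
  unfold dirVal
  linear_combination cos φ * h0 + sin φ * h1 + sqrt (d 0 ^ 2 + d 1 ^ 2) * sin_sq_add_cos_sq φ

lemma dist_suppPt_le (hlam : 0 < lam) (hK : IsLamConvexBody lam K) (a b : ℝ) :
    dist (suppPt K a) (suppPt K b)
      ≤ dist (1 / lam * prim (dens lam K) a) (1 / lam * prim (dens lam K) b) := by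
  have hD := density_dens lam K
  wlog hab : a ≤ b generalizing a b
  · rw [dist_comm, dist_comm (1 / lam * prim (dens lam K) a)]; exact this b a (le_of_not_ge hab)
  rw [dist_comm, dist_comm (1 / lam * prim (dens lam K) a), dist_eq_norm, Real.dist_eq]
  refine le_trans ?_ (le_abs_self _)
  obtain ⟨φ, hφ⟩ := exists_dirVal_eq_norm (suppPt K b - suppPt K a)
  rw [← hφ, dirVal_suppPt_sub hlam hK, ← mul_sub, hD.prim_sub]
  refine mul_le_mul_of_nonneg_left ?_ (by positivity)
  refine intervalIntegral.integral_mono_on hab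
    (hD.intervalIntegrable_mul (g := fun s => sin (φ - s)) (by fun_prop) a b)
    (hD.intervalIntegrable a b) fun s _ => mul_le_of_le_one_right (hD.nonneg s) (sin_le_one _)

/-- The hypothesis makes `f` factor through `g` by a map that is 1-Lipschitz on the range of `g`;
with `g` the arc length this bounds the boundary length from above. -/
lemma hausdorffMeasure_image_le_of_dist_le {α X : Type*} [MetricSpace X] [MeasurableSpace X]
    [BorelSpace X] [Nonempty α] {f : α → X} {g : α → ℝ}
    (h : ∀ a b, dist (f a) (f b) ≤ dist (g a) (g b)) (A : Set α) :
    Measure.hausdorffMeasure 1 (f '' A) ≤ volume (g '' A) := by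
  set y : ℝ → X := fun σ => f (Function.invFun g σ) with hy
  have hyg : ∀ a, y (g a) = f a := fun a => by
    have h1 : g (Function.invFun g (g a)) = g a := Function.invFun_eq ⟨a, rfl⟩
    have := h (Function.invFun g (g a)) a
    rw [h1, dist_self] at this
    exact dist_le_zero.1 this
  have hlip : LipschitzOnWith 1 y (g '' A) := by
    apply LipschitzOnWith.of_dist_le_mul
    rintro _ ⟨a, _, rfl⟩ _ ⟨b, _, rfl⟩
    rw [hyg, hyg, NNReal.coe_one, one_mul]
    exact h a b
  have := hlip.hausdorffMeasure_image_le (d := 1) zero_le_one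
  rw [image_image, hausdorffMeasure_real] at this
  simpa [hyg] using this

lemma frontier_eq_image (hlam : 0 < lam) (hK : IsLamConvexBody lam K) :
    frontier K = suppPt K '' Icc 0 (2 * π) := by
  apply Subset.antisymm
  · intro p hp
    obtain ⟨θ, hθ⟩ := exists_isSupp_of_mem_frontier hK.toIsPlanarConvexBody hp
    obtain ⟨δ, h1, h2, h3, h4⟩ := exists_reduced_angle π θ
    refine ⟨π + δ, ⟨by linarith, by linarith⟩, ?_⟩
    rw [suppPt_congr h3 h4]
    exact (eq_suppPt hlam hK hθ).symm
  · rintro _ ⟨θ, _, rfl⟩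
    exact (suppPt_spec hK.toIsPlanarConvexBody θ).mem_frontier

lemma hausdorffMeasure_frontier_le (hlam : 0 < lam) (hK : IsLamConvexBody lam K) :
    Measure.hausdorffMeasure 1 (frontier K)
      ≤ ENNReal.ofReal (1 / lam * prim (dens lam K) (2 * π)) := by
  have hD := density_dens lam K
  rw [frontier_eq_image hlam hK]
  refine (hausdorffMeasure_image_le_of_dist_le
    (g := fun t => 1 / lam * prim (dens lam K) t) (dist_suppPt_le hlam hK) _).trans ?_
  have hsub : (fun t => 1 / lam * prim (dens lam K) t) '' Icc 0 (2 * π)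
      ⊆ Icc 0 (1 / lam * prim (dens lam K) (2 * π)) := by
    rintro _ ⟨t, ht, rfl⟩
    have h1 := hD.prim_mono ht.1
    have h2 := hD.prim_mono ht.2
    rw [Density.prim_zero] at h1
    exact ⟨by positivity, mul_le_mul_of_nonneg_left h2 (by positivity)⟩
  refine (measure_mono hsub).trans ?_
  simp

lemma lipschitzWith_dirVal (φ : ℝ) : LipschitzWith 1 fun p : Plane => dirVal p φ := by
  apply LipschitzWith.of_dist_le_mul
  intro p q
  rw [Real.dist_eq, dist_eq_norm, ← dirVal_sub, NNReal.coe_one, one_mul]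
  exact abs_dirVal_le _ _

/-- Projection onto the tangent direction at `a` does not increase length, and along the arc the
tangent turns by at most `b - a`, which costs at most the factor `cos (b - a)`. -/
lemma le_hausdorffMeasure_arc (hlam : 0 < lam) (hK : IsLamConvexBody lam K) {a b : ℝ}
    (hab : a ≤ b) (hb : b ≤ a + π / 2) :
    ENNReal.ofReal (1 / lam * cos (b - a) * (prim (dens lam K) b - prim (dens lam K) a))
      ≤ Measure.hausdorffMeasure 1 (suppPt K '' Icc a b) := by
  have hD := density_dens lam K
  set f := fun p : Plane => dirVal p (a + π / 2) with hf
  have h1 := (lipschitzWith_dirVal (a + π / 2)).hausdorffMeasure_image_le (d := 1) zero_le_one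
    (suppPt K '' Icc a b)
  simp only [ENNReal.coe_one, ENNReal.one_rpow, one_mul] at h1
  refine le_trans ?_ h1
  rw [hausdorffMeasure_real, image_image]
  have hc : ContinuousOn (fun t => dirVal (suppPt K t) (a + π / 2)) (Icc a b) :=
    ((continuous_dirVal_left _).comp (continuous_suppPt hlam hK)).continuousOn
  refine le_trans ?_ (measure_mono (intermediate_value_Icc hab hc))
  rw [Real.volume_Icc]
  apply ENNReal.ofReal_le_ofReal
  rw [← dirVal_sub, dirVal_suppPt_sub hlam hK, hD.prim_sub, mul_assoc,
    ← intervalIntegral.integral_const_mul]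
  refine mul_le_mul_of_nonneg_left ?_ (by positivity)
  refine intervalIntegral.integral_mono_on hab ((hD.intervalIntegrable a b).const_mul _)
    (hD.intervalIntegrable_mul (g := fun s => sin (a + π / 2 - s)) (by fun_prop) a b) fun s hs => ?_
  rw [mul_comm]
  refine mul_le_mul_of_nonneg_left ?_ (hD.nonneg s)
  rw [show a + π / 2 - s = π / 2 - (s - a) by ring, sin_pi_div_two_sub]
  exact cos_le_cos_of_nonneg_of_le_pi (by linarith [hs.1]) (by linarith [pi_pos])
    (by linarith [hs.2])

/-- The normals of a point form a convex cone: if `t - s < π` it covers `[s, t]`, and if `t - s > π`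
it covers the complementary angles, hence `2 * π`. -/
lemma suppPt_eq_of_eq (hlam : 0 < lam) (hK : IsLamConvexBody lam K) {s t : ℝ} (hs : 0 ≤ s)
    (ht : t ≤ 2 * π) (h : suppPt K s = suppPt K t) :
    (∀ u ∈ Icc s t, suppPt K u = suppPt K s) ∨ suppPt K s = suppPt K 0 := by
  have hb := hK.toIsPlanarConvexBody
  have h1 := suppPt_spec hb s
  have h2 := suppPt_spec hb t
  rw [← h] at h2
  rcases lt_trichotomy (t - s) π with hlt | heq | hgt
  · left
    intro u hu
    exact (eq_suppPt hlam hK (h1.cone h2 hu.1 hu.2 hlt)).symm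
  · exact (not_isSupp_antipodal hb h1 (by rwa [← heq, add_sub_cancel])).elim
  · right
    have h3 : IsSupp K (suppPt K s) (s + 2 * π) := by
      rwa [isSupp_congr (cos_add_two_pi s) (sin_add_two_pi s)]
    have h4 := h2.cone h3 ht (by linarith) (by linarith)
    rw [eq_suppPt hlam hK h4]
    have := suppPt_periodic K 0
    rwa [zero_add] at this

lemma le_hausdorffMeasure_frontier (hlam : 0 < lam) (hK : IsLamConvexBody lam K) {n : ℕ}
    (hn : 4 ≤ n) :
    ENNReal.ofReal (1 / lam * cos (2 * π / n) * prim (dens lam K) (2 * π))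
      ≤ Measure.hausdorffMeasure 1 (frontier K) := by
  have hD := density_dens lam K
  have hn0 : (0 : ℝ) < n := by exact_mod_cast (by omega : 0 < n)
  have hn4 : (4 : ℝ) ≤ n := by exact_mod_cast hn
  set δ := 2 * π / n with hδ
  have hδ0 : 0 < δ := by positivity
  have hδ2 : δ ≤ π / 2 := by
    rw [hδ, div_le_iff₀ hn0]; nlinarith [pi_pos]
  have hnδ : n * δ = 2 * π := by rw [hδ]; field_simp
  have hcos : 0 ≤ cos δ := cos_nonneg_of_mem_Icc ⟨by linarith [pi_pos], hδ2⟩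
  set arc : ℕ → Set Plane := fun i => suppPt K '' Icc (i * δ) ((i + 1 : ℕ) * δ) with harc
  have hmono : ∀ i j : ℕ, i ≤ j → (i : ℝ) * δ ≤ j * δ := fun i j hij => by gcongr
  have hmeas : ∀ i, MeasurableSet (arc i) := fun i =>
    (isCompact_Icc.image (continuous_suppPt hlam hK)).measurableSet
  have hdisj : ∀ i j : ℕ, i < j → j < n → AEDisjoint (Measure.hausdorffMeasure 1) (arc i) (arc j) := by
    intro i j hij hjn
    -- A common point either has all normals between the arcs, including `j * δ`, or is the support
    -- point at angle `0`. The overlap is finite, hence null.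
    have hsub : arc i ∩ arc j ⊆ {suppPt K 0, suppPt K (j * δ)} := by
      rintro p ⟨⟨s, hs, hsp⟩, ⟨t, ht, htp⟩⟩
      have k1 := hmono (i + 1) j hij
      have k2 := hmono (j + 1) n hjn
      have k3 : (0 : ℝ) ≤ i * δ := by positivity
      rcases suppPt_eq_of_eq hlam hK (s := s) (t := t) (k3.trans hs.1)
        (by rw [← hnδ]; exact ht.2.trans k2)
        (hsp.trans htp.symm) with h | h
      · right
        rw [mem_singleton_iff, h _ ⟨hs.2.trans k1, ht.1⟩, hsp]
      · left; rw [← hsp, h]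
    have := Measure.nullSingletonClass_hausdorff Plane (d := 1) one_pos
    exact measure_mono_null hsub ((Set.toFinite _).measure_zero _)
  have hpair : (↑(Finset.range n) : Set ℕ).Pairwise
      (Function.onFun (AEDisjoint (Measure.hausdorffMeasure 1)) arc) := by
    intro i hi j hj hij
    rw [Finset.coe_range, mem_Iio] at hi hj
    rcases lt_or_gt_of_ne hij with h | h
    · exact hdisj i j h hj
    · exact (hdisj j i h hi).symm
  have hsum := measure_biUnion_finset₀ hpair (fun i _ => (hmeas i).nullMeasurableSet)
  have hunion : (⋃ i ∈ Finset.range n, arc i) ⊆ frontier K := by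
    refine iUnion₂_subset fun i _ => ?_
    rintro _ ⟨θ, _, rfl⟩
    exact (suppPt_spec hK.toIsPlanarConvexBody θ).mem_frontier
  refine le_trans ?_ (measure_mono hunion)
  rw [hsum]
  have hlow : ∀ i ∈ Finset.range n, ENNReal.ofReal (1 / lam * cos δ *
      (prim (dens lam K) ((i + 1 : ℕ) * δ) - prim (dens lam K) (i * δ)))
      ≤ Measure.hausdorffMeasure 1 (arc i) := by
    intro i _
    have e : ((i + 1 : ℕ) : ℝ) * δ - i * δ = δ := by push_cast; ring
    have := le_hausdorffMeasure_arc hlam hK (hmono i (i + 1) (by omega)) (by linarith)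
    rwa [e] at this
  refine le_trans ?_ (Finset.sum_le_sum hlow)
  rw [← ENNReal.ofReal_sum_of_nonneg]
  · apply ENNReal.ofReal_le_ofReal
    rw [← Finset.mul_sum, Finset.sum_range_sub (fun i : ℕ => prim (dens lam K) (i * δ)), hnδ]
    simp [Density.prim_zero]
  · intro i _
    have := hD.prim_mono (hmono i (i + 1) (by omega))
    exact mul_nonneg (by positivity) (by linarith)

theorem hausdorffMeasure_frontier (hlam : 0 < lam) (hK : IsLamConvexBody lam K) :
    Measure.hausdorffMeasure 1 (frontier K)
      = ENNReal.ofReal (1 / lam * prim (dens lam K) (2 * π)) := by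
  refine le_antisymm (hausdorffMeasure_frontier_le hlam hK) ?_
  have ht : Tendsto (fun n : ℕ => ENNReal.ofReal
      (1 / lam * cos (2 * π / n) * prim (dens lam K) (2 * π))) atTop
      (𝓝 (ENNReal.ofReal (1 / lam * cos 0 * prim (dens lam K) (2 * π)))) := by
    refine ENNReal.tendsto_ofReal ?_
    have := (continuous_cos.tendsto 0).comp (tendsto_const_div_atTop_nhds_zero_nat (2 * π))
    exact (this.const_mul _).mul_const _
  rw [cos_zero, mul_one] at ht
  exact le_of_tendsto ht ((eventually_ge_atTop 4).mono fun n hn =>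
    le_hausdorffMeasure_frontier hlam hK hn)

theorem boundaryLength_eq (hlam : 0 < lam) (hK : IsLamConvexBody lam K) :
    boundaryLength K = 1 / lam * prim (dens lam K) (2 * π) := by
  have hD := density_dens lam K
  have h1 := hD.prim_mono two_pi_pos.le
  rw [Density.prim_zero] at h1
  rw [boundaryLength, hausdorffMeasure_frontier hlam hK, ENNReal.toReal_ofReal (by positivity)]

/-! ### Area -/

lemma volume_eq_lintegral_slices (hK : MeasurableSet K) :
    volume K = ∫⁻ x : ℝ, volume {y : ℝ | (!₂[x, y] : Plane) ∈ K} := by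
  have h1 := EuclideanSpace.volume_preserving_symm_measurableEquiv_toLp (Fin 2)
  have h2 := (volume_preserving_finTwoArrow ℝ).comp h1
  set e : Plane ≃ᵐ ℝ × ℝ := (MeasurableEquiv.toLp 2 (Fin 2 → ℝ)).symm.trans
    MeasurableEquiv.finTwoArrow with he
  have h3 : MeasurePreserving e.symm := MeasurePreserving.symm e h2
  rw [← h3.measure_preimage hK.nullMeasurableSet, Measure.volume_eq_prod,
    Measure.prod_apply (e.symm.measurable hK)]
  rfl

lemma le_suppY_of_upper (hlam : 0 < lam) (hK : IsLamConvexBody lam K) {θ : ℝ} (h0 : 0 ≤ θ)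
    (hπ : θ ≤ π) {q : Plane} (hq : q ∈ K) (hx : q 0 = suppX K θ) : q 1 ≤ suppY K θ := by
  by_contra! hlt
  have hs := sin_nonneg_of_nonneg_of_le_pi h0 hπ
  have := eq_suppPt hlam hK ((suppPt_spec hK.toIsPlanarConvexBody θ).of_dirVal_ge hq (by
    unfold dirVal
    rw [hx]
    exact add_le_add le_rfl (mul_le_mul_of_nonneg_right hlt.le hs)))
  rw [this] at hlt
  exact lt_irrefl _ hlt

lemma suppY_le_of_lower (hlam : 0 < lam) (hK : IsLamConvexBody lam K) {θ : ℝ} (h0 : π ≤ θ)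
    (hπ : θ ≤ 2 * π) {q : Plane} (hq : q ∈ K) (hx : q 0 = suppX K θ) : suppY K θ ≤ q 1 := by
  by_contra! hlt
  have hs : sin θ ≤ 0 := by
    have := sin_nonneg_of_nonneg_of_le_pi (sub_nonneg.2 h0) (by linarith : θ - π ≤ π)
    rw [sin_sub_pi] at this
    linarith
  have := eq_suppPt hlam hK ((suppPt_spec hK.toIsPlanarConvexBody θ).of_dirVal_ge hq (by
    unfold dirVal
    rw [hx]
    exact add_le_add le_rfl (mul_le_mul_of_nonpos_right hlt.le hs)))
  rw [this] at hlt
  exact lt_irrefl _ hlt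

lemma suppPt_mem (hK : IsPlanarConvexBody K) (θ : ℝ) : suppPt K θ ∈ K := (suppPt_spec hK θ).1

lemma slice_eq (hlam : 0 < lam) (hK : IsLamConvexBody lam K) {θ θ' x : ℝ}
    (hθ : θ ∈ Icc 0 π) (hθ' : θ' ∈ Icc π (2 * π)) (hx : suppX K θ = x) (hx' : suppX K θ' = x) :
    {y : ℝ | (!₂[x, y] : Plane) ∈ K} = Icc (suppY K θ') (suppY K θ) := by
  have hb := hK.toIsPlanarConvexBody
  ext y
  constructor
  · intro hy
    exact ⟨suppY_le_of_lower hlam hK hθ'.1 hθ'.2 hy hx'.symm,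
      le_suppY_of_upper hlam hK hθ.1 hθ.2 hy hx.symm⟩
  · intro hy
    have hseg : (!₂[x, y] : Plane) ∈ segment ℝ (suppPt K θ') (suppPt K θ) := by
      rw [← segment_eq_Icc (hy.1.trans hy.2)] at hy
      obtain ⟨a, b, ha, hb, hab, rfl⟩ := hy
      refine ⟨a, b, ha, hb, hab, plane_ext ?_ rfl⟩
      change a * suppX K θ' + b * suppX K θ = x
      rw [hx, hx', ← add_mul, hab, one_mul]
    exact hK.convex.segment_subset (suppPt_mem hb _) (suppPt_mem hb _) hseg

lemma slice_empty (hK : IsPlanarConvexBody K) {x : ℝ}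
    (hx : x ∉ Icc (suppX K π) (suppX K 0)) : {y : ℝ | (!₂[x, y] : Plane) ∈ K} = ∅ := by
  rw [eq_empty_iff_forall_notMem]
  intro y hy
  have h1 := (suppPt_spec hK 0).2 _ hy
  have h2 := (suppPt_spec hK π).2 _ hy
  simp only [dirVal, cos_zero, sin_zero, cos_pi, sin_pi, mul_zero, add_zero, mul_one, mul_neg,
    neg_le_neg_iff] at h1 h2
  exact hx ⟨h2, h1⟩

/-- A continuous function that factors through a continuous function on a compact interval factors
through it continuously. -/
lemma exists_continuous_factor {X Y : ℝ → ℝ} (hX : Continuous X) (hY : Continuous Y) (a b : ℝ)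
    (h : ∀ s ∈ Icc a b, ∀ t ∈ Icc a b, X s = X t → Y s = Y t) :
    ∃ g : ℝ → ℝ, Continuous g ∧ ∀ t ∈ Icc a b, g (X t) = Y t := by
  set C := X '' Icc a b with hC
  have hCc : IsClosed C := (isCompact_Icc.image hX).isClosed
  let f : C(Icc a b, C) := ⟨fun t => ⟨X t, t, t.2, rfl⟩, by fun_prop⟩
  have hf : IsQuotientMap f := by
    refine f.continuous.isClosedMap.isQuotientMap f.continuous ?_
    rintro ⟨_, t, ht, rfl⟩
    exact ⟨⟨t, ht⟩, rfl⟩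
  let y : C(Icc a b, ℝ) := ⟨fun t => Y t, by fun_prop⟩
  have hfac : Function.FactorsThrough y f := fun s t hst =>
    h s s.2 t t.2 (congrArg Subtype.val hst)
  obtain ⟨g, hg⟩ := ContinuousMap.exists_restrict_eq hCc (hf.lift y hfac)
  refine ⟨g, g.continuous, fun t ht => ?_⟩
  have h1 := congrArg (fun k => k ⟨X t, t, ht, rfl⟩) hg
  have h2 := congrArg (fun k => k ⟨t, ht⟩) (hf.lift_comp y hfac)
  exact h1.trans h2

lemma integral_comp_mul_of_lipschitz {X X' g : ℝ → ℝ} {C : NNReal} (hX : LipschitzWith C X)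
    (hX' : ∀ᵐ t, HasDerivAt X (X' t) t) (hg : Continuous g) (a b : ℝ) :
    ∫ t in a..b, g (X t) * X' t = ∫ x in X a..X b, g x := by
  set G : ℝ → ℝ := fun z => ∫ x in (0 : ℝ)..z, g x with hG
  have hGd : ∀ z, HasDerivAt G (g z) z := fun z => (hg.integral_hasStrictDerivAt 0 z).hasDerivAt
  have hGc : ContDiff ℝ 1 G := by
    rw [contDiff_one_iff_deriv]
    refine ⟨fun z => (hGd z).differentiableAt, ?_⟩
    rwa [funext fun z => (hGd z).deriv]
  rw [integral_eq_sub_of_absCont (absCont_comp hGc hX a b)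
    (hX'.mono fun t ht => (hGd (X t)).comp t ht)]
  exact intervalIntegral.integral_interval_sub_left (hg.intervalIntegrable _ _)
    (hg.intervalIntegrable _ _)

lemma suppX_two_pi (K : Set Plane) : suppX K (2 * π) = suppX K 0 := by
  have := suppPt_periodic K 0
  rw [zero_add] at this
  rw [suppX, suppX, this]

lemma suppY_two_pi (K : Set Plane) : suppY K (2 * π) = suppY K 0 := by
  have := suppPt_periodic K 0
  rw [zero_add] at this
  rw [suppY, suppY, this]

/-- Normals in `[0, π]` trace the upper boundary and those in `[π, 2 * π]` the lower one, as
continuous graphs over the first coordinate. Substituting that coordinate in the slice formula gives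
`-∮ y dx`. -/
lemma planarArea_eq_integral_suppY (hlam : 0 < lam) (hK : IsLamConvexBody lam K) :
    planarArea K = ∫ t in (0 : ℝ)..(2 * π), suppY K t * (1 / lam * dens lam K t * sin t) := by
  have hb := hK.toIsPlanarConvexBody
  have hD := density_dens lam K
  have hXl := lipschitzWith_suppX hlam hK
  have hYl := lipschitzWith_suppY hlam hK
  have hX' := (ae_hasDerivAt_supp hlam hK).mono fun _ h => h.1
  have hpi := pi_pos
  obtain ⟨g, hg, hgX⟩ := exists_continuous_factor hXl.continuous hYl.continuous 0 π (by
    intro s hs t ht hst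
    exact le_antisymm (le_suppY_of_upper hlam hK ht.1 ht.2 (suppPt_mem hb s) hst)
      (le_suppY_of_upper hlam hK hs.1 hs.2 (suppPt_mem hb t) hst.symm))
  obtain ⟨f, hf, hfX⟩ := exists_continuous_factor hXl.continuous hYl.continuous π (2 * π) (by
    intro s hs t ht hst
    exact le_antisymm (suppY_le_of_lower hlam hK hs.1 hs.2 (suppPt_mem hb t) hst.symm)
      (suppY_le_of_lower hlam hK ht.1 ht.2 (suppPt_mem hb s) hst))
  have hex : ∀ x ∈ Icc (suppX K π) (suppX K 0), ∃ θ ∈ Icc 0 π, suppX K θ = x := fun x hx =>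
    intermediate_value_Icc' hpi.le hXl.continuous.continuousOn hx
  have hex' : ∀ x ∈ Icc (suppX K π) (suppX K 0), ∃ θ ∈ Icc π (2 * π), suppX K θ = x := fun x hx =>
    intermediate_value_Icc (by linarith) hXl.continuous.continuousOn (by rwa [suppX_two_pi])
  have hle : suppX K π ≤ suppX K 0 := by
    have := (suppPt_spec hb 0).2 _ (suppPt_mem hb π)
    simpa [dirVal, suppX] using this
  have hslice : ∀ x ∈ Icc (suppX K π) (suppX K 0),
      {y : ℝ | (!₂[x, y] : Plane) ∈ K} = Icc (f x) (g x) ∧ f x ≤ g x := by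
    intro x hx
    obtain ⟨θ, hθ, hθx⟩ := hex x hx
    obtain ⟨θ', hθ', hθx'⟩ := hex' x hx
    have e1 : g x = suppY K θ := by rw [← hθx]; exact hgX θ hθ
    have e2 : f x = suppY K θ' := by rw [← hθx']; exact hfX θ' hθ'
    rw [e1, e2]
    exact ⟨slice_eq hlam hK hθ hθ' hθx hθx',
      le_suppY_of_upper hlam hK hθ.1 hθ.2 (suppPt_mem hb θ') (hθx'.trans hθx.symm)⟩
  have hvol : volume K = ∫⁻ x in Icc (suppX K π) (suppX K 0), ENNReal.ofReal (g x - f x) := by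
    rw [volume_eq_lintegral_slices hK.isCompact.measurableSet,
      ← lintegral_indicator measurableSet_Icc]
    congr 1; ext x
    by_cases hx : x ∈ Icc (suppX K π) (suppX K 0)
    · rw [indicator_of_mem hx, (hslice x hx).1, Real.volume_Icc]
    · rw [indicator_of_notMem hx, slice_empty hb hx, measure_empty]
  have harea : planarArea K = ∫ x in suppX K π..suppX K 0, (g x - f x) := by
    rw [planarArea, hvol, intervalIntegral.integral_of_le hle, ← integral_Icc_eq_integral_Ioc,
      integral_eq_lintegral_of_nonneg_ae]
    · refine (ae_restrict_iff' measurableSet_Icc).2 (Eventually.of_forall fun x hx => ?_)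
      exact sub_nonneg.2 (hslice x hx).2
    · exact (hg.sub hf).aestronglyMeasurable
  have i1 := integral_comp_mul_of_lipschitz hXl hX' hg 0 π
  have i2 := integral_comp_mul_of_lipschitz hXl hX' hf π (2 * π)
  rw [suppX_two_pi] at i2
  have hint : ∀ a b, IntervalIntegrable (fun t => suppY K t * (1 / lam * dens lam K t * sin t))
      volume a b := by
    intro a b
    have hc := hYl.continuous
    refine (hD.intervalIntegrable_mul (g := fun t => suppY K t * (1 / lam * sin t))
      (by fun_prop) a b).congr fun s _ => ?_
    ring
  rw [harea, intervalIntegral.integral_sub (hg.intervalIntegrable _ _) (hf.intervalIntegrable _ _),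
    ← i2, intervalIntegral.integral_symm, ← i1,
    ← intervalIntegral.integral_add_adjacent_intervals (hint 0 π) (hint π (2 * π)),
    sub_eq_add_neg, ← intervalIntegral.integral_neg, ← intervalIntegral.integral_neg]
  congr 1
  · refine intervalIntegral.integral_congr fun t ht => ?_
    rw [uIcc_of_le hpi.le] at ht
    simp only [hgX t ht]; ring
  · refine intervalIntegral.integral_congr fun t ht => ?_
    rw [uIcc_of_le (by linarith)] at ht
    simp only [hfX t ht]; ring

/-- Integrating the derivative of `x * y` over a period shows `∮ x dy = -∮ y dx`; the half sum has
the support function as integrand. -/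
lemma planarArea_eq_integral_suppFn (hlam : 0 < lam) (hK : IsLamConvexBody lam K) :
    planarArea K = 1 / 2 * ∫ t in (0 : ℝ)..(2 * π), 1 / lam * (dens lam K t * suppFn K t) := by
  have hD := density_dens lam K
  have hXl := lipschitzWith_suppX hlam hK
  have hYl := lipschitzWith_suppY hlam hK
  have hXc := hXl.continuous
  have hYc := hYl.continuous
  have key := integral_eq_sub_of_absCont (a := 0) (b := 2 * π)
    ((absCont_of_lipschitz hXl _ _).fun_mul (absCont_of_lipschitz hYl _ _))
    ((ae_hasDerivAt_supp hlam hK).mono fun _ h => h.1.mul h.2)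
  rw [suppX_two_pi, suppY_two_pi, sub_self] at key
  have i1 : IntervalIntegrable (fun t => suppY K t * (1 / lam * dens lam K t * sin t))
      volume 0 (2 * π) := by
    refine (hD.intervalIntegrable_mul (g := fun t => suppY K t * (1 / lam * sin t))
      (by fun_prop) _ _).congr fun s _ => ?_
    ring
  have i2 : IntervalIntegrable (fun t => suppX K t * (1 / lam * dens lam K t * cos t))
      volume 0 (2 * π) := by
    refine (hD.intervalIntegrable_mul (g := fun t => suppX K t * (1 / lam * cos t))
      (by fun_prop) _ _).congr fun s _ => ?_
    ring
  have e1 : ∫ t in (0 : ℝ)..(2 * π), suppX K t * (1 / lam * dens lam K t * cos t)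
      = ∫ t in (0 : ℝ)..(2 * π), suppY K t * (1 / lam * dens lam K t * sin t) := by
    rw [← sub_eq_zero, ← intervalIntegral.integral_sub i2 i1, ← key]
    congr 1; ext t; ring
  have e2 : ∫ t in (0 : ℝ)..(2 * π), 1 / lam * (dens lam K t * suppFn K t)
      = (∫ t in (0 : ℝ)..(2 * π), suppX K t * (1 / lam * dens lam K t * cos t))
        + ∫ t in (0 : ℝ)..(2 * π), suppY K t * (1 / lam * dens lam K t * sin t) := by
    rw [← intervalIntegral.integral_add i2 i1]
    congr 1; ext t
    simp only [suppFn, dirVal, suppX, suppY]; ring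
  rw [e2, e1, planarArea_eq_integral_suppY hlam hK]; ring

/-- The density seen from the normal angle `p`. -/
noncomputable def shiftDens (lam : ℝ) (K : Set Plane) (p t : ℝ) : ℝ := dens lam K (p + t)

lemma density_shiftDens (lam : ℝ) (K : Set Plane) (p : ℝ) : Density (shiftDens lam K p) where
  meas := (density_dens lam K).meas.comp (measurable_const_add p)
  nonneg _ := (density_dens lam K).nonneg _
  le_one _ := (density_dens lam K).le_one _

/-- The support function is that of the fixed point `suppPt K p` plus the contribution of the arc
traversed since `p`. The first part integrates to the cross product of that point with the chord. -/
lemma half_integral (hlam : 0 < lam) (hK : IsLamConvexBody lam K) (p : ℝ) :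
    ∫ t in p..(p + π), 1 / lam * (dens lam K t * suppFn K t)
      = (1 / lam) ^ 2 * Density.arcArea (shiftDens lam K p)
        + (suppX K p * (suppY K (p + π) - suppY K p)
          - suppY K p * (suppX K (p + π) - suppX K p)) := by
  have hD := density_dens lam K
  have hS := density_shiftDens lam K p
  have e0 : ∀ t, suppFn K (p + t) = dirVal (suppPt K p) (p + t)
      + 1 / lam * ∫ s in (0 : ℝ)..t, shiftDens lam K p s * sin (t - s) := by
    intro t
    have h1 := dirVal_suppPt_sub hlam hK p (p + t) (p + t)
    have h2 := intervalIntegral.integral_comp_add_left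
      (fun s => dens lam K s * sin (p + t - s)) p (a := 0) (b := t)
    rw [add_zero] at h2
    rw [← h2, dirVal_sub] at h1
    have h3 : ∀ s, sin (p + t - (p + s)) = sin (t - s) := fun s => by congr 1; ring
    simp only [h3] at h1
    unfold suppFn shiftDens
    linarith
  rw [suppY_sub hlam hK, suppX_sub hlam hK, ← intervalIntegral.integral_const_mul,
    ← intervalIntegral.integral_const_mul, ← intervalIntegral.integral_sub]
  rotate_left
  · refine (hD.intervalIntegrable_mul (g := fun t => suppX K p * (1 / lam * cos t))
      (by fun_prop) _ _).congr fun s _ => ?_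
    ring
  · refine (hD.intervalIntegrable_mul (g := fun t => suppY K p * -(1 / lam * sin t))
      (by fun_prop) _ _).congr fun s _ => ?_
    ring
  have hcont : Continuous fun t => ∫ s in (0 : ℝ)..t, shiftDens lam K p s * sin (t - s) :=
    hS.continuous_integral_mul (g := fun s t => sin (t - s)) (by fun_prop)
  have c1 := intervalIntegral.integral_comp_add_left
      (fun t => 1 / lam * (dens lam K t * suppFn K t)) p (a := 0) (b := π)
  have c2 := intervalIntegral.integral_comp_add_left
      (fun t => suppX K p * (1 / lam * dens lam K t * cos t)
        - suppY K p * -(1 / lam * dens lam K t * sin t)) p (a := 0) (b := π)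
  rw [add_zero] at c1 c2
  rw [← c1, ← c2, Density.arcArea, ← intervalIntegral.integral_const_mul,
    ← intervalIntegral.integral_add]
  · congr 1; ext t
    rw [e0]
    simp only [shiftDens, dirVal, suppX, suppY]
    ring
  · exact (hS.intervalIntegrable_mul hcont _ _).const_mul _
  · refine (hS.intervalIntegrable_mul (g := fun t => suppX K p * (1 / lam * cos (p + t))
      - suppY K p * -(1 / lam * sin (p + t))) (by fun_prop) _ _).congr fun s _ => ?_
    simp only [shiftDens]
    ring

/-- The cross products of the two halves have opposite signs and cancel. -/
theorem planarArea_eq (hlam : 0 < lam) (hK : IsLamConvexBody lam K) (p : ℝ) :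
    planarArea K = 1 / 2 * (1 / lam) ^ 2 * (Density.arcArea (shiftDens lam K p)
      + Density.arcArea (shiftDens lam K (p + π))) := by
  have hD := density_dens lam K
  have hper : Function.Periodic (fun t => 1 / lam * (dens lam K t * suppFn K t)) (2 * π) := by
    intro t
    simp only [dens_periodic lam K t, suppFn, suppPt_periodic K t, dirVal_periodic _ t]
  have h1 := hper.intervalIntegral_add_eq 0 p
  rw [zero_add] at h1
  have hint : ∀ a b, IntervalIntegrable (fun t => 1 / lam * (dens lam K t * suppFn K t))
      volume a b := fun a b =>
    (hD.intervalIntegrable_mul (continuous_suppFn hlam hK) a b).const_mul _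
  have h2 := half_integral hlam hK p
  have h3 := half_integral hlam hK (p + π)
  rw [planarArea_eq_integral_suppFn hlam hK, h1,
    ← intervalIntegral.integral_add_adjacent_intervals (hint p (p + π)) (hint (p + π) _),
    show p + 2 * π = p + π + π by ring, h2, h3, show p + π + π = p + 2 * π by ring]
  have hX : suppX K (p + 2 * π) = suppX K p := by rw [suppX, suppX, suppPt_periodic]
  have hY : suppY K (p + 2 * π) = suppY K p := by rw [suppY, suppY, suppPt_periodic]
  rw [hX, hY]; ring

/-! ### Corners and circular arcs -/

/-- All normals in `[a, b]` belong to one boundary point. -/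
def Gap (K : Set Plane) (a b : ℝ) : Prop := ∀ t ∈ Icc a b, suppPt K t = suppPt K a

/-- The boundary points with normals in `[a, b]` lie on one circle of radius `1 / lam`. -/
def Arc (lam : ℝ) (K : Set Plane) (a b : ℝ) : Prop :=
  ∀ t ∈ Icc a b, suppPt K t - (1 / lam) • dir t = suppPt K a - (1 / lam) • dir a

lemma dir_periodic : Function.Periodic dir (2 * π) := fun t =>
  plane_ext (by simp) (by simp)

lemma Gap.trans {a b c : ℝ} (h1 : Gap K a b) (h2 : Gap K b c) (hab : a ≤ b) : Gap K a c := by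
  intro t ht
  rcases le_total t b with h | h
  · exact h1 t ⟨ht.1, h⟩
  · rw [h2 t ⟨h, ht.2⟩, h1 b ⟨hab, le_rfl⟩]

lemma Arc.trans {a b c : ℝ} (h1 : Arc lam K a b) (h2 : Arc lam K b c) (hab : a ≤ b) :
    Arc lam K a c := by
  intro t ht
  rcases le_total t b with h | h
  · exact h1 t ⟨ht.1, h⟩
  · rw [h2 t ⟨h, ht.2⟩, h1 b ⟨hab, le_rfl⟩]

lemma Gap.refl (a : ℝ) : Gap K a a := fun t ht => by rw [le_antisymm ht.2 ht.1]

lemma Gap.shift {a b : ℝ} (h : Gap K a b) : Gap K (a + 2 * π) (b + 2 * π) := by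
  intro t ht
  have := h (t - 2 * π) ⟨by linarith [ht.1], by linarith [ht.2]⟩
  rwa [(suppPt_periodic K).sub_eq, ← suppPt_periodic K a] at this

lemma Gap.unshift {a b : ℝ} (h : Gap K (a + 2 * π) (b + 2 * π)) : Gap K a b := by
  intro t ht
  have := h (t + 2 * π) ⟨by linarith [ht.1], by linarith [ht.2]⟩
  rwa [suppPt_periodic K, suppPt_periodic K] at this

lemma Arc.shift {a b : ℝ} (h : Arc lam K a b) : Arc lam K (a + 2 * π) (b + 2 * π) := by
  intro t ht
  have := h (t - 2 * π) ⟨by linarith [ht.1], by linarith [ht.2]⟩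
  rwa [(suppPt_periodic K).sub_eq, dir_periodic.sub_eq, ← suppPt_periodic K a,
    ← dir_periodic a] at this

lemma Gap.lt_pi (hK : IsPlanarConvexBody K) {a b : ℝ} (h : Gap K a b) : b - a < π := by
  by_contra! hcon
  have h1 := h (a + π) ⟨by linarith [pi_pos], by linarith⟩
  have h2 := suppPt_spec hK (a + π)
  rw [h1] at h2
  exact not_isSupp_antipodal hK (suppPt_spec hK a) h2

/-- The body lies in every disc of radius `1 / lam` tangent to it from outside. -/
lemma subset_closedBall (hlam : 0 < lam) (hK : IsLamConvexBody lam K) (θ : ℝ) :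
    K ⊆ closedBall (suppPt K θ - (1 / lam) • dir θ) (1 / lam) := by
  intro q hq
  have hr : 0 < 1 / lam := by positivity
  rw [mem_closedBall, dist_eq_norm]
  obtain ⟨φ, hφ⟩ := exists_dirVal_eq_norm (q - (suppPt K θ - (1 / lam) • dir θ))
  rw [← hφ]
  obtain ⟨δ, h1, h2, h3, h4⟩ := exists_reduced_angle θ φ
  have hcongr : ∀ p : Plane, dirVal p φ = dirVal p (θ + δ) := fun p => by
    simp only [dirVal, h3, h4]
  have key : ∀ δ ∈ Ioo (-π) π, suppFn K (θ + δ) ≤ dirVal (suppPt K θ) (θ + δ)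
      + 1 / lam * (1 - cos δ) := by
    intro δ hδ
    rcases le_total 0 δ with h | h
    · simpa using suppFn_le_disc hlam hK (a := θ) (s := 1) (Or.inl rfl) h hδ.2
    · simpa using suppFn_le_disc hlam hK (a := θ) (s := -1) (δ := -δ) (Or.inr rfl)
        (by linarith) (by linarith [hδ.1])
  -- The comparison holds for `|δ| < π`; the antipodal direction follows by continuity.
  have key2 : suppFn K (θ + δ) ≤ dirVal (suppPt K θ) (θ + δ) + 1 / lam * (1 - cos δ) := by
    have hcl : IsClosed {δ | suppFn K (θ + δ) ≤ dirVal (suppPt K θ) (θ + δ)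
        + 1 / lam * (1 - cos δ)} := by
      refine isClosed_le ((continuous_suppFn hlam hK).comp (by fun_prop)) ?_
      unfold dirVal; fun_prop
    have hsub := closure_minimal (show Ioo (-π) π ⊆ _ from key) hcl
    rw [closure_Ioo (by linarith [pi_pos])] at hsub
    exact hsub ⟨h1.le, h2⟩
  have h5 := (suppPt_spec hK.toIsPlanarConvexBody (θ + δ)).2 q hq
  rw [hcongr, dirVal_sub, dirVal_sub, dirVal_smul, dirVal_dir, add_sub_cancel_left]
  unfold suppFn at key2
  linarith

lemma Gap.dirVal_le (hK : IsPlanarConvexBody K) {a b φ : ℝ} (h : Gap K a b) {z : Plane}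
    (ha : dirVal z a ≤ suppFn K a) (hb : dirVal z b ≤ suppFn K b) (hφ : φ ∈ Icc a b) :
    dirVal z φ ≤ suppFn K φ := by
  have hab := h.lt_pi hK
  rcases (hφ.1.trans hφ.2).eq_or_lt with heq | hlt
  · have : φ = a := le_antisymm (heq ▸ hφ.2) hφ.1
    rwa [this]
  have hs : 0 < sin (b - a) := sin_pos_of_pos_of_lt_pi (by linarith) hab
  have s1 : 0 ≤ sin (b - φ) :=
    sin_nonneg_of_nonneg_of_le_pi (by linarith [hφ.2]) (by linarith [hφ.1])
  have s2 : 0 ≤ sin (φ - a) :=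
    sin_nonneg_of_nonneg_of_le_pi (by linarith [hφ.1]) (by linarith [hφ.2])
  unfold suppFn at *
  rw [h b ⟨hlt.le, le_rfl⟩] at hb
  rw [h φ hφ]
  refine le_of_mul_le_mul_right ?_ hs
  rw [dirVal_cone z a b, dirVal_cone (suppPt K a) a b]
  exact add_le_add (mul_le_mul_of_nonneg_right ha s1) (mul_le_mul_of_nonneg_right hb s2)

lemma Arc.dirVal_le (hlam : 0 < lam) {a b φ : ℝ} (h : Arc lam K a b) {z : Plane}
    (hz : z ∈ closedBall (suppPt K a - (1 / lam) • dir a) (1 / lam)) (hφ : φ ∈ Icc a b) :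
    dirVal z φ ≤ suppFn K φ := by
  rw [← h φ hφ] at hz
  have := dirVal_le_of_mem_closedBall (by positivity) hz φ
  rw [dirVal_sub, dirVal_smul, dirVal_dir, sub_self, cos_zero] at this
  unfold suppFn
  linarith

/-- The discs are those of the two arcs. A point of both obeys the support inequality at the normals
of the arcs, hence at the ends of each corner, and so at all normals of the corner by
`Gap.dirVal_le`. -/
lemma isLamConvexLens_of_two_arcs (hlam : 0 < lam) (hK : IsLamConvexBody lam K) {a b c d : ℝ}
    (hbc : b ≤ c) (hda : d ≤ a + 2 * π) (h1 : Gap K a b) (h2 : Arc lam K b c) (h3 : Gap K c d) (h4 : Arc lam K d (a + 2 * π)) :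
    IsLamConvexLens lam K := by
  have hb := hK.toIsPlanarConvexBody
  refine ⟨hK.interior_nonempty, suppPt K b - (1 / lam) • dir b, suppPt K d - (1 / lam) • dir d,
    Subset.antisymm (subset_inter (subset_closedBall hlam hK b) (subset_closedBall hlam hK d)) ?_⟩
  rintro z ⟨hz1, hz2⟩
  have hper : ∀ θ, dirVal z θ ≤ suppFn K θ ↔ dirVal z (θ + 2 * π) ≤ suppFn K (θ + 2 * π) := by
    intro θ
    simp only [suppFn, suppPt_periodic K θ, dirVal_periodic _ θ]
  have key : ∀ φ ∈ Icc a (a + 2 * π), dirVal z φ ≤ suppFn K φ := by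
    intro φ hφ
    rcases le_total φ b with hφb | hφb
    · refine h1.dirVal_le hb ?_ (h2.dirVal_le hlam hz1 ⟨le_rfl, hbc⟩) ⟨hφ.1, hφb⟩
      rw [hper]
      exact h4.dirVal_le hlam hz2 ⟨hda, le_rfl⟩
    rcases le_total φ c with hφc | hφc
    · exact h2.dirVal_le hlam hz1 ⟨hφb, hφc⟩
    rcases le_total φ d with hφd | hφd
    · exact h3.dirVal_le hb (h2.dirVal_le hlam hz1 ⟨hbc, le_rfl⟩)
        (h4.dirVal_le hlam hz2 ⟨le_rfl, hda⟩) ⟨hφc, hφd⟩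
    · exact h4.dirVal_le hlam hz2 ⟨hφd, hφ.2⟩
  refine mem_of_forall_dirVal_le hb fun θ => ?_
  obtain ⟨δ, k1, k2, k3, k4⟩ := exists_reduced_angle (a + π) θ
  have := key (a + π + δ) ⟨by linarith, by linarith⟩
  simp only [suppFn, suppPt_congr (K := K) k3 k4] at this
  simpa only [dirVal, k3, k4] using this

/-! ### From densities to corners and arcs -/

lemma prim_shiftDens (lam : ℝ) (K : Set Plane) (p t : ℝ) :
    prim (shiftDens lam K p) t = prim (dens lam K) (p + t) - prim (dens lam K) p := by
  rw [(density_dens lam K).prim_sub, prim]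
  have := intervalIntegral.integral_comp_add_left (dens lam K) p (a := 0) (b := t)
  rw [add_zero] at this
  exact this

/-- The deviation from a circular arc is an integral against `1 - ρ`; it vanishes where `coprim` is
constant. -/
lemma norm_suppPt_sub_arc_le (hlam : 0 < lam) (hK : IsLamConvexBody lam K) {s t : ℝ}
    (hst : s ≤ t) :
    ‖suppPt K t - suppPt K s - (1 / lam) • (dir t - dir s)‖
      ≤ 1 / lam * ((t - s) - (prim (dens lam K) t - prim (dens lam K) s)) := by
  have hD := density_dens lam K
  obtain ⟨φ, hφ⟩ := exists_dirVal_eq_norm (suppPt K t - suppPt K s - (1 / lam) • (dir t - dir s))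
  rw [← hφ, dirVal_sub, dirVal_smul, dirVal_suppPt_sub hlam hK, dirVal_sub, dirVal_dir, dirVal_dir,
    ← mul_sub]
  refine mul_le_mul_of_nonneg_left ?_ (by positivity)
  have e1 : cos (φ - t) - cos (φ - s) = ∫ u in s..t, sin (φ - u) := by
    rw [intervalIntegral.integral_comp_sub_left (fun u => sin u) φ, integral_sin]
  have e2 : (t - s) - (prim (dens lam K) t - prim (dens lam K) s)
      = ∫ u in s..t, (1 - dens lam K u) := by
    rw [intervalIntegral.integral_sub (by simp) (hD.intervalIntegrable _ _), hD.prim_sub]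
    simp
  have i1 := hD.intervalIntegrable_mul (g := fun u => sin (φ - u)) (by fun_prop) s t
  have i2 : IntervalIntegrable (fun u => sin (φ - u)) volume s t :=
    (by fun_prop : Continuous fun u => sin (φ - u)).intervalIntegrable _ _
  rw [e1, e2, ← intervalIntegral.integral_sub i1 i2]
  refine intervalIntegral.integral_mono_on hst (i1.sub i2)
    ((by simp : IntervalIntegrable (fun _ => (1 : ℝ)) volume s t).sub (hD.intervalIntegrable _ _))
    fun u _ => ?_
  have h1 := hD.le_one u
  have h2 := neg_one_le_sin (φ - u)
  nlinarith

lemma gap_of_constOn (hlam : 0 < lam) (hK : IsLamConvexBody lam K) {p a b : ℝ}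
    (h : ConstOn (prim (shiftDens lam K p)) a b) : Gap K (p + a) (p + b) := by
  intro t ht
  have h1 := h (t - p) ⟨by linarith [ht.1], by linarith [ht.2]⟩
  rw [prim_shiftDens, prim_shiftDens, add_sub_cancel] at h1
  have h2 := dist_suppPt_le hlam hK t (p + a)
  rw [sub_left_inj.1 h1, dist_self] at h2
  exact dist_le_zero.1 h2

lemma arc_of_constOn (hlam : 0 < lam) (hK : IsLamConvexBody lam K) {p a b : ℝ}
    (h : ConstOn (coprim (shiftDens lam K p)) a b) : Arc lam K (p + a) (p + b) := by
  intro t ht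
  have h1 := h (t - p) ⟨by linarith [ht.1], by linarith [ht.2]⟩
  unfold coprim at h1
  rw [prim_shiftDens, prim_shiftDens, add_sub_cancel] at h1
  have h2 := norm_suppPt_sub_arc_le hlam hK ht.1
  have e : t - (p + a) - (prim (dens lam K) t - prim (dens lam K) (p + a)) = 0 := by linarith
  rw [e, mul_zero, norm_le_zero_iff, smul_sub] at h2
  rw [← sub_eq_zero, ← h2]
  abel

/-- If all alternatives fail, sum-to-product formulas make the left side at least `2 * sin (l / 2) ^
2` and the right side strictly smaller. -/
lemma arc_angles {γ l α b : ℝ} (hγ : 0 ≤ γ) (hγl : γ + l ≤ π) (hα : 0 ≤ α) (hb : 0 ≤ b)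
    (hl : α + b = l) (h : cos γ - cos (γ + l) = 2 - cos α - cos b) : α = 0 ∨ b = 0 ∨ l = π := by
  by_contra! hcon
  obtain ⟨h1, h2, h3⟩ := hcon
  have hα : 0 < α := lt_of_le_of_ne hα h1.symm
  have hb : 0 < b := lt_of_le_of_ne hb h2.symm
  have hlπ : l < π := lt_of_le_of_ne (by linarith) h3
  have e1 : cos γ - cos (γ + l) = 2 * sin (l / 2) * sin (γ + l / 2) := by
    rw [cos_sub_cos, show (γ + (γ + l)) / 2 = γ + l / 2 by ring,
      show (γ - (γ + l)) / 2 = -(l / 2) by ring, sin_neg]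
    ring
  have e2 : cos α + cos b = 2 * cos (l / 2) * cos ((α - b) / 2) := by
    rw [cos_add_cos, hl]
  have hs : 0 < sin (l / 2) := sin_pos_of_pos_of_lt_pi (by linarith) (by linarith)
  have hc : 0 < cos (l / 2) := cos_pos_of_mem_Ioo ⟨by linarith, by linarith⟩
  have k1 : sin (l / 2) ≤ sin (γ + l / 2) := by
    rw [← sub_nonneg, sin_sub_sin, show (γ + l / 2 - l / 2) / 2 = γ / 2 by ring,
      show (γ + l / 2 + l / 2) / 2 = (γ + l) / 2 by ring]
    have := sin_nonneg_of_nonneg_of_le_pi (x := γ / 2) (by linarith) (by linarith)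
    have := cos_nonneg_of_mem_Icc (x := (γ + l) / 2) ⟨by linarith, by linarith⟩
    positivity
  have k2 : cos (l / 2) < cos ((α - b) / 2) := by
    rw [← cos_abs ((α - b) / 2)]
    refine cos_lt_cos_of_nonneg_of_le_pi (abs_nonneg _) (by linarith) ?_
    rw [abs_lt]; constructor <;> linarith
  have := sin_sq_add_cos_sq (l / 2)
  nlinarith [mul_le_mul_of_nonneg_left k1 hs.le, mul_lt_mul_of_pos_left k2 hc]

/-- On the half circle of normals starting at `p` there is one arc between two corners. -/
def HasMidArc (lam : ℝ) (K : Set Plane) (p l : ℝ) : Prop :=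
  ∃ γ δ, 0 ≤ γ ∧ γ ≤ δ ∧ δ ≤ π ∧ δ - γ = l ∧ Gap K p (p + γ) ∧ Arc lam K (p + γ) (p + δ) ∧
    Gap K (p + δ) (p + π)

/-- On the half circle of normals starting at `p` there is one corner between two arcs. -/
def HasMidGap (lam : ℝ) (K : Set Plane) (p l : ℝ) : Prop :=
  ∃ α β, 0 ≤ α ∧ α ≤ β ∧ β ≤ π ∧ α + (π - β) = l ∧ Arc lam K p (p + α) ∧ Gap K (p + α) (p + β) ∧
    Arc lam K (p + β) (p + π)

lemma HasMidGap.shift {p l : ℝ} (h : HasMidGap lam K p l) : HasMidGap lam K (p + 2 * π) l := by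
  obtain ⟨α, β, b0, b1, b2, b3, b4, b5, b6⟩ := h
  refine ⟨α, β, b0, b1, b2, b3, ?_, ?_, ?_⟩
  · convert b4.shift using 1; ring
  · convert b5.shift using 1 <;> ring
  · convert b6.shift using 1 <;> ring

/-- The displacements along the three arcs add up to zero. Their component along `dir p` is the
relation in `arc_angles`, and in each of its alternatives the two arcs of the second half reduce to
one. -/
lemma HasMidGap.toMidArc (hlam : 0 < lam) {p l : ℝ}
    (hI : HasMidArc lam K p l) (hW : HasMidGap lam K (p + π) l) : HasMidArc lam K (p + π) l := by
  obtain ⟨γ, δ, a0, a1, a2, a3, a4, a5, a6⟩ := hI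
  obtain ⟨α, β, b0, b1, b2, b3, b4, b5, b6⟩ := hW
  have hpi := pi_pos
  have c1 := a4 (p + γ) ⟨by linarith, le_rfl⟩
  have c2 := a5 (p + δ) ⟨by linarith, le_rfl⟩
  have c3 := a6 (p + π) ⟨by linarith, le_rfl⟩
  have c4 := b4 (p + π + α) ⟨by linarith, le_rfl⟩
  have c5 := b5 (p + π + β) ⟨by linarith, le_rfl⟩
  have c6 := b6 (p + π + π) ⟨by linarith, le_rfl⟩
  have c7 : suppPt K (p + π + π) = suppPt K p := by
    rw [show p + π + π = p + 2 * π by ring, suppPt_periodic]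
  have hclose : (1 / lam) • (dir (p + δ) - dir (p + γ) + dir (p + π + α) - dir (p + π)
      + dir (p + π + π) - dir (p + π + β)) = 0 := by
    have e1 := congrArg₂ (· + ·) (congrArg₂ (· + ·) c2 c4) c6
    simp only [c1, c3, c5, c7] at e1
    simp only [smul_sub, smul_add]
    rw [← sub_eq_zero] at e1
    rw [← neg_eq_zero, ← e1]
    abel
  rw [smul_eq_zero] at hclose
  have hclose := hclose.resolve_left (by positivity)
  have hv := congrArg (fun v => dirVal v p) hclose
  simp only [dirVal_sub, dirVal_add, dirVal_dir] at hv
  rw [show p - (p + δ) = -δ by ring, show p - (p + γ) = -γ by ring,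
    show p - (p + π + α) = -(α + π) by ring, show p - (p + π) = -π by ring,
    show p - (p + π + π) = -(2 * π) by ring, show p - (p + π + β) = -(β + π) by ring] at hv
  simp only [cos_neg, cos_add_pi, cos_pi, cos_two_pi] at hv
  have h0 : dirVal (0 : Plane) p = 0 := by simp [dirVal]
  rw [h0] at hv
  have hang := arc_angles (γ := γ) (l := l) (α := α) (b := π - β) a0 (by linarith) b0
    (by linarith) b3 (by rw [cos_pi_sub, show γ + l = δ by linarith]; linarith)
  rcases hang with h | h | h
  · subst h
    refine ⟨β, π, by linarith, b2, le_rfl, by linarith, ?_, b6, Gap.refl _⟩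
    simpa using b5
  · have : β = π := by linarith
    subst this
    refine ⟨0, α, le_rfl, b0, b1, by linarith, ?_, ?_, b5⟩
    · rw [add_zero]; exact Gap.refl _
    · rw [add_zero]; exact b4
  · have : α = β := by linarith
    subst this
    refine ⟨0, π, le_rfl, hpi.le, le_rfl, by linarith, ?_, ?_, Gap.refl _⟩
    · rw [add_zero]; exact Gap.refl _
    · rw [add_zero]; exact b4.trans b6 (by linarith)

/-- The corners meeting at the cuts `p` and `p + π` merge, leaving two corners and two arcs. -/
lemma lens_of_midArc_midArc (hlam : 0 < lam) (hK : IsLamConvexBody lam K) {p l : ℝ}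
    (h1 : HasMidArc lam K p l) (h2 : HasMidArc lam K (p + π) l) : IsLamConvexLens lam K := by
  obtain ⟨γ, δ, a0, a1, a2, a3, a4, a5, a6⟩ := h1
  obtain ⟨γ', δ', b0, b1, b2, b3, b4, b5, b6⟩ := h2
  have hg : Gap K (p + π + δ' - 2 * π) p := by
    apply Gap.unshift
    convert b6 using 1 <;> ring
  refine isLamConvexLens_of_two_arcs hlam hK (a := p + π + δ' - 2 * π) (b := p + γ) (c := p + δ)
    (d := p + π + γ') (by linarith) (by linarith)
    (hg.trans a4 (by linarith)) a5 (a6.trans b4 (by linarith)) ?_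
  convert b5 using 1; ring

lemma lens_of_midGap_midGap (hlam : 0 < lam) (hK : IsLamConvexBody lam K) {p l : ℝ}
    (h1 : HasMidGap lam K p l) (h2 : HasMidGap lam K (p + π) l) : IsLamConvexLens lam K := by
  obtain ⟨γ, δ, a0, a1, a2, a3, a4, a5, a6⟩ := h1
  obtain ⟨γ', δ', b0, b1, b2, b3, b4, b5, b6⟩ := h2
  have hg : Arc lam K (p + π + π) (p + γ + 2 * π) := by
    convert a4.shift using 1; ring
  exact isLamConvexLens_of_two_arcs hlam hK (a := p + γ) (b := p + δ) (c := p + π + γ')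
    (d := p + π + δ') (by linarith) (by linarith)
    a5 (a6.trans b4 (by linarith)) b5 (b6.trans hg (by linarith))

lemma lens_of_halves (hlam : 0 < lam) (hK : IsLamConvexBody lam K) {p l : ℝ}
    (h1 : HasMidArc lam K p l ∨ HasMidGap lam K p l)
    (h2 : HasMidArc lam K (p + π) l ∨ HasMidGap lam K (p + π) l) : IsLamConvexLens lam K := by
  have e : p + π + π = p + 2 * π := by ring
  rcases h1 with h1 | h1 <;> rcases h2 with h2 | h2
  · exact lens_of_midArc_midArc hlam hK h1 h2
  · exact lens_of_midArc_midArc hlam hK h1 (HasMidGap.toMidArc hlam h1 h2)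
  · have h1' : HasMidGap lam K (p + π + π) l := e ▸ h1.shift
    exact lens_of_midArc_midArc hlam hK h2 (HasMidGap.toMidArc hlam h2 h1')
  · exact lens_of_midGap_midGap hlam hK h1 h2

lemma half_structure (hlam : 0 < lam) (hK : IsLamConvexBody lam K) {p : ℝ}
    (hl : 0 < prim (shiftDens lam K p) π)
    (heq : Density.arcArea (shiftDens lam K p)
      = prim (shiftDens lam K p) π - sin (prim (shiftDens lam K p) π)) :
    HasMidArc lam K p (prim (shiftDens lam K p) π) ∨
      HasMidGap lam K p (prim (shiftDens lam K p) π) := by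
  have S0 : prim (shiftDens lam K p) 0 = 0 := Density.prim_zero
  rcases (density_shiftDens lam K p).structure_of_eq heq hl with
    ⟨γ, δ, h0, h1, h2, h3, h4, h5⟩ | ⟨α, β, h0, h1, h2, h3, h4, h5⟩
  · refine Or.inl ⟨γ, δ, h0, h1, h2, ?_, ?_, arc_of_constOn hlam hK h4, gap_of_constOn hlam hK h5⟩
    · have k1 := h3 γ ⟨h0, le_rfl⟩
      have k2 := h4 δ ⟨h1, le_rfl⟩
      have k3 := h5 π ⟨h2, le_rfl⟩
      unfold coprim at k2
      linarith
    · simpa using gap_of_constOn hlam hK h3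
  · refine Or.inr ⟨α, β, h0, h1, h2, ?_, ?_, gap_of_constOn hlam hK h4, arc_of_constOn hlam hK h5⟩
    · have k1 := h3 α ⟨h0, le_rfl⟩
      have k2 := h4 β ⟨h1, le_rfl⟩
      have k3 := h5 π ⟨h2, le_rfl⟩
      unfold coprim at k1 k3
      linarith
    · simpa using arc_of_constOn hlam hK h3

/-! ### The inequality -/

lemma prim_dens_add_two_pi (lam : ℝ) (K : Set Plane) (p : ℝ) :
    prim (dens lam K) (p + 2 * π) = prim (dens lam K) p + prim (dens lam K) (2 * π) := by
  have h1 := (dens_periodic lam K).intervalIntegral_add_eq 0 p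
  rw [zero_add, ← (density_dens lam K).prim_sub, ← (density_dens lam K).prim_sub,
    Density.prim_zero] at h1
  linarith

lemma prim_shiftDens_add (lam : ℝ) (K : Set Plane) (p : ℝ) :
    prim (shiftDens lam K p) π + prim (shiftDens lam K (p + π)) π
      = prim (dens lam K) (2 * π) := by
  rw [prim_shiftDens, prim_shiftDens, show p + π + π = p + 2 * π by ring, prim_dens_add_two_pi]
  ring

/-- The masses over the half circles at `0` and `π` add up to the total, so they lie on opposite
sides of its half and the intermediate value theorem applies. -/
lemma exists_halving (lam : ℝ) (K : Set Plane) :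
    ∃ p, prim (shiftDens lam K p) π = prim (dens lam K) (2 * π) / 2 ∧
      prim (shiftDens lam K (p + π)) π = prim (dens lam K) (2 * π) / 2 := by
  have hc : Continuous fun p => prim (shiftDens lam K p) π := by
    simp_rw [prim_shiftDens]
    have := (density_dens lam K).prim_continuous
    fun_prop
  have h0 := prim_shiftDens_add lam K 0
  obtain ⟨p, hp⟩ : ∃ p, prim (shiftDens lam K p) π = prim (dens lam K) (2 * π) / 2 := by
    rcases le_total (prim (shiftDens lam K 0) π) (prim (dens lam K) (2 * π) / 2) with h | h
    · exact mem_range_of_exists_le_of_exists_ge hc ⟨0, h⟩ ⟨0 + π, by linarith⟩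
    · exact mem_range_of_exists_le_of_exists_ge hc ⟨0 + π, by linarith⟩ ⟨0, h⟩
  have := prim_shiftDens_add lam K p
  exact ⟨p, hp, by linarith⟩

lemma prim_dens_two_pi_pos (hlam : 0 < lam) (hK : IsLamConvexBody lam K) :
    0 < prim (dens lam K) (2 * π) := by
  have hb := hK.toIsPlanarConvexBody
  have hD := density_dens lam K
  by_contra! hcon
  have h1 := hD.prim_mono pi_pos.le
  have h2 := hD.prim_mono (by linarith [pi_pos] : π ≤ 2 * π)
  have h0 : prim (dens lam K) 0 = 0 := Density.prim_zero
  have h3 := dist_suppPt_le hlam hK 0 π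
  rw [h0, show prim (dens lam K) π = 0 by linarith, dist_self] at h3
  have h4 := suppPt_spec hb π
  rw [← dist_le_zero.1 h3] at h4
  exact not_isSupp_antipodal hb (suppPt_spec hb 0) (by rwa [zero_add])

/-- The area bound in terms of the total mass of the curvature density. -/
lemma bound_eq (hlam : 0 < lam) (hK : IsLamConvexBody lam K) :
    boundaryLength K / (2 * lam) - 1 / lam ^ 2 * sin (boundaryLength K * lam / 2)
      = (1 / lam) ^ 2 * (prim (dens lam K) (2 * π) / 2 - sin (prim (dens lam K) (2 * π) / 2)) := by
  rw [boundaryLength_eq hlam hK]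
  have e : 1 / lam * prim (dens lam K) (2 * π) * lam / 2 = prim (dens lam K) (2 * π) / 2 := by
    field_simp
  rw [e]
  field_simp

/-! ### Lenses -/

lemma dens_eq_one_of_eq (hlam : 0 < lam) {c : Plane} {t : ℝ}
    (h : ∀ᶠ s in 𝓝 t, suppPt K s = c + (1 / lam) • dir s) : dens lam K t = 1 := by
  have hX : HasDerivAt (suppX K) (1 / lam * -sin t) t := by
    refine (((hasDerivAt_cos t).const_mul (1 / lam)).const_add (c 0)).congr_of_eventuallyEq ?_
    filter_upwards [h] with s hs
    simp [suppX, hs]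
  have hY : HasDerivAt (suppY K) (1 / lam * cos t) t := by
    refine (((hasDerivAt_sin t).const_mul (1 / lam)).const_add (c 1)).congr_of_eventuallyEq ?_
    filter_upwards [h] with s hs
    simp [suppY, hs]
  have e : lam * (1 / lam * cos t * cos t - 1 / lam * -sin t * sin t) = 1 := by
    have : lam * (1 / lam) = 1 := by field_simp
    linear_combination (cos t ^ 2 + sin t ^ 2) * this + sin_sq_add_cos_sq t
  rw [dens, hX.deriv, hY.deriv, e]
  simp

lemma dens_eq_zero_of_eq {c : Plane} {t : ℝ} (h : ∀ᶠ s in 𝓝 t, suppPt K s = c) :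
    dens lam K t = 0 := by
  have hX : HasDerivAt (suppX K) 0 t := by
    refine (hasDerivAt_const t (c 0)).congr_of_eventuallyEq ?_
    filter_upwards [h] with s hs
    simp [suppX, hs]
  have hY : HasDerivAt (suppY K) 0 t := by
    refine (hasDerivAt_const t (c 1)).congr_of_eventuallyEq ?_
    filter_upwards [h] with s hs
    simp [suppY, hs]
  rw [dens, hX.deriv, hY.deriv]
  simp

namespace Density
variable {ρ : ℝ → ℝ}

lemma prim_sub_of_eq_const (h : Density ρ) {a b v : ℝ} (hab : a ≤ b)
    (hv : ∀ t ∈ Ioo a b, ρ t = v) : prim ρ b - prim ρ a = v * (b - a) := by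
  rw [h.prim_sub, intervalIntegral.integral_of_le hab, integral_Ioc_eq_integral_Ioo,
    setIntegral_congr_fun measurableSet_Ioo hv]
  simp [hab, mul_comm]

/-- The indicator of an interval attains equality. -/
lemma eq_of_indicator (h : Density ρ) {γ δ : ℝ} (h0 : 0 ≤ γ) (h1 : γ ≤ δ) (h2 : δ ≤ π)
    (k0 : ∀ t ∈ Ioo 0 γ, ρ t = 0) (k1 : ∀ t ∈ Ioo γ δ, ρ t = 1) (k2 : ∀ t ∈ Ioo δ π, ρ t = 0) :
    prim ρ π = δ - γ ∧ arcArea ρ = (δ - γ) - sin (δ - γ) := by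
  have p1 := h.prim_sub_of_eq_const h0 k0
  have p2 := h.prim_sub_of_eq_const h1 k1
  have p3 := h.prim_sub_of_eq_const h2 k2
  have S0 : prim ρ 0 = 0 := prim_zero
  have hl : prim ρ π = δ - γ := by linarith
  refine ⟨hl, ?_⟩
  -- On the mass of `ρ` the increment of `coprim ρ` is zero, so the chord bound is exact there.
  have hT : ∀ t ∈ Icc γ δ, coprim ρ t = coprim ρ γ := by
    intro t ht
    have := h.prim_sub_of_eq_const ht.1 (fun s hs => k1 s ⟨hs.1, hs.2.trans_le ht.2⟩)
    unfold coprim; linarith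
  have hdef : ∀ s ∈ Icc γ δ, ∀ t ∈ Icc γ δ, defect ρ s t = 0 := by
    intro s hs t ht
    have e := coprim_add_prim ρ s t
    rw [hT s hs, hT t ht, sub_self, add_zero] at e
    unfold defect minorant
    rw [hT s hs, hT t ht, e]
    simp
  have hinner : ∀ t ∈ Icc γ δ, ∫ s in (0 : ℝ)..t, ρ s * defect ρ s t = 0 := by
    intro t ht
    rw [intervalIntegral.integral_of_le (h0.trans ht.1)]
    refine setIntegral_eq_zero_of_forall_eq_zero fun s hs => ?_
    rcases lt_or_ge s γ with hsγ | hsγ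
    · rw [k0 s ⟨hs.1, hsγ⟩, zero_mul]
    · rw [hdef s ⟨hsγ, hs.2.trans ht.2⟩ t ht, mul_zero]
  have hzero : ∫ t in (0 : ℝ)..π, ρ t * ∫ s in (0 : ℝ)..t, ρ s * defect ρ s t = 0 := by
    rw [intervalIntegral.integral_of_le pi_pos.le, integral_Ioc_eq_integral_Ioo]
    refine setIntegral_eq_zero_of_forall_eq_zero fun t ht => ?_
    rcases lt_or_ge t γ with hγ | hγ
    · rw [k0 t ⟨ht.1, hγ⟩, zero_mul]
    rcases le_or_gt t δ with hδ | hδ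
    · rw [hinner t ⟨hγ, hδ⟩, mul_zero]
    · rw [k2 t ⟨hδ, ht.2⟩, zero_mul]
  rw [h.arcArea_eq, hzero, hl, add_zero]

end Density

/-- The centres are `2 * (1 / lam * cos η)` apart, so each circle contributes an arc of half angle
`η`: when `|θ - ω| ≤ η`, the point at `θ` of the circle about `b` lies in the disc about `a`. -/
lemma lens_arc (hlam : 0 < lam) (hK : IsLamConvexBody lam K) {a b : Plane} {ω η : ℝ}
    (hKab : K = closedBall a (1 / lam) ∩ closedBall b (1 / lam))
    (hab : a - b = (2 * (1 / lam * cos η)) • dir ω) (hη0 : 0 ≤ η) (hη : η ≤ π / 2) {θ : ℝ}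
    (hθ : |θ - ω| ≤ η) : suppPt K θ = b + (1 / lam) • dir θ := by
  have hr : 0 < 1 / lam := by positivity
  refine (eq_suppPt hlam hK ⟨?_, fun q hq => ?_⟩).symm
  · rw [hKab]
    have hc0 : 0 ≤ cos η := cos_nonneg_of_mem_Icc ⟨by linarith, hη⟩
    have hcos : cos η ≤ cos (θ - ω) := by
      rw [← cos_abs (θ - ω)]
      exact cos_le_cos_of_nonneg_of_le_pi (abs_nonneg _) (by linarith [pi_pos]) hθ
    rw [cos_sub] at hcos
    have ha : a = b + (2 * (1 / lam * cos η)) • dir ω := by rw [← hab]; abel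
    constructor
    · rw [mem_closedBall_iff hr.le, ha]
      simp only [PiLp.add_apply, PiLp.smul_apply, dir_zero, dir_one, smul_eq_mul]
      have e : (b 0 + 1 / lam * cos θ - (b 0 + 2 * (1 / lam * cos η) * cos ω)) ^ 2
          + (b 1 + 1 / lam * sin θ - (b 1 + 2 * (1 / lam * cos η) * sin ω)) ^ 2
          = (1 / lam) ^ 2 + 4 * (1 / lam) ^ 2 * cos η * (cos η - (cos θ * cos ω + sin θ * sin ω)) := by
        linear_combination (1 / lam) ^ 2 * sin_sq_add_cos_sq θ
          + 4 * (1 / lam) ^ 2 * cos η ^ 2 * sin_sq_add_cos_sq ω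
      rw [e]
      have : 4 * (1 / lam) ^ 2 * cos η * (cos η - (cos θ * cos ω + sin θ * sin ω)) ≤ 0 :=
        mul_nonpos_of_nonneg_of_nonpos (by positivity) (by linarith)
      linarith
    · rw [mem_closedBall, dist_eq_norm, add_sub_cancel_left, norm_smul, norm_dir, mul_one,
        Real.norm_of_nonneg hr.le]
  · rw [hKab] at hq
    rw [dirVal_add, dirVal_smul, dirVal_dir, sub_self, cos_zero, mul_one]
    exact dirVal_le_of_mem_closedBall hr.le hq.2 θ

/-- The ends of the two circular arcs coincide in a vertex of the lens, whose normal cone fills the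
angles between. -/
lemma lens_gap (hlam : 0 < lam) (hK : IsLamConvexBody lam K) {a b : Plane} {ω η : ℝ}
    (hKab : K = closedBall a (1 / lam) ∩ closedBall b (1 / lam))
    (hab : a - b = (2 * (1 / lam * cos η)) • dir ω) (hη0 : 0 < η) (hη : η ≤ π / 2) :
    Gap K (ω + η) (ω + π - η) := by
  have hb := hK.toIsPlanarConvexBody
  have h1 := lens_arc hlam hK hKab hab hη0.le hη (θ := ω + η)
    (by rw [add_sub_cancel_left, abs_of_pos hη0])
  have hba : b - a = (2 * (1 / lam * cos η)) • dir (ω + π) := by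
    have : dir (ω + π) = - dir ω := plane_ext (by simp) (by simp)
    rw [this, smul_neg, ← hab]; abel
  have h2 := lens_arc hlam hK (hKab.trans (inter_comm _ _)) hba hη0.le hη (θ := ω + π - η)
    (by rw [sub_sub_cancel_left, abs_neg, abs_of_pos hη0])
  have heq : suppPt K (ω + η) = suppPt K (ω + π - η) := by
    have ha : a = b + (2 * (1 / lam * cos η)) • dir ω := by rw [← hab]; abel
    rw [h1, h2, ha]
    apply plane_ext
    · simp only [PiLp.add_apply, PiLp.smul_apply, dir_zero, smul_eq_mul]
      rw [show ω + π - η = (ω - η) + π by ring, cos_add_pi, cos_add, cos_sub]; ring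
    · simp only [PiLp.add_apply, PiLp.smul_apply, dir_one, smul_eq_mul]
      rw [show ω + π - η = (ω - η) + π by ring, sin_add_pi, sin_add, sin_sub]; ring
  intro t ht
  have s2 := suppPt_spec hb (ω + π - η)
  rw [← heq] at s2
  exact (eq_suppPt hlam hK ((suppPt_spec hb (ω + η)).cone s2 ht.1 ht.2 (by linarith))).symm

lemma Gap.dens_eq_zero {a b t : ℝ} (h : Gap K a b) (ht : t ∈ Ioo a b) : dens lam K t = 0 :=
  dens_eq_zero_of_eq (c := suppPt K a) (by
    filter_upwards [isOpen_Ioo.mem_nhds ht] with s hs using h s ⟨hs.1.le, hs.2.le⟩)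

lemma lens_half (hlam : 0 < lam) (hK : IsLamConvexBody lam K) {a b : Plane} {ω η : ℝ}
    (hKab : K = closedBall a (1 / lam) ∩ closedBall b (1 / lam))
    (hab : a - b = (2 * (1 / lam * cos η)) • dir ω) (hη0 : 0 < η) (hη : η ≤ π / 2) :
    prim (shiftDens lam K (ω - π / 2)) π = 2 * η ∧
      Density.arcArea (shiftDens lam K (ω - π / 2)) = 2 * η - sin (2 * η) := by
  have hpi := pi_pos
  have hba : b - a = (2 * (1 / lam * cos η)) • dir (ω - π) := by
    have : dir (ω - π) = - dir ω := plane_ext (by simp) (by simp)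
    rw [this, smul_neg, ← hab]; abel
  have g1 := lens_gap hlam hK hKab hab hη0 hη
  have g2 := lens_gap hlam hK (hKab.trans (inter_comm _ _)) hba hη0 hη
  have key := (density_shiftDens lam K (ω - π / 2)).eq_of_indicator (γ := π / 2 - η)
    (δ := π / 2 + η) (by linarith) (by linarith) (by linarith) ?_ ?_ ?_
  · rwa [show π / 2 + η - (π / 2 - η) = 2 * η by ring] at key
  · intro t ht
    exact g2.dens_eq_zero ⟨by linarith [ht.1], by linarith [ht.2]⟩
  · intro t ht
    refine dens_eq_one_of_eq hlam (c := b) ?_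
    have hmem : ω - π / 2 + t ∈ Ioo (ω - η) (ω + η) :=
      ⟨by linarith [ht.1], by linarith [ht.2]⟩
    filter_upwards [isOpen_Ioo.mem_nhds hmem] with s hs
    exact lens_arc hlam hK hKab hab hη0.le hη
      (abs_le.2 ⟨by linarith [hs.1], by linarith [hs.2]⟩)
  · intro t ht
    exact g1.dens_eq_zero ⟨by linarith [ht.1], by linarith [ht.2]⟩

/-- `η` is the arccosine of half the distance of the centres over the radius. If that half distance
were at least the radius, the discs would share at most the midpoint, against non-empty interior. -/
lemma exists_lens_angle (hlam : 0 < lam) (hK : IsLamConvexBody lam K) {a b : Plane}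
    (hKab : K = closedBall a (1 / lam) ∩ closedBall b (1 / lam)) :
    ∃ ω η, a - b = (2 * (1 / lam * cos η)) • dir ω ∧ 0 < η ∧ η ≤ π / 2 := by
  have hb := hK.toIsPlanarConvexBody
  have hr : 0 < 1 / lam := by positivity
  obtain ⟨ω, h0, h1⟩ := exists_polar ((a 0 - b 0) / 2) ((a 1 - b 1) / 2)
  set κ := sqrt (((a 0 - b 0) / 2) ^ 2 + ((a 1 - b 1) / 2) ^ 2) with hκ
  have hκ0 : 0 ≤ κ := sqrt_nonneg _
  have hκsq : κ ^ 2 = ((a 0 - b 0) / 2) ^ 2 + ((a 1 - b 1) / 2) ^ 2 := sq_sqrt (by positivity)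
  have hlt : κ < 1 / lam := by
    by_contra! hcon
    have hsq : (1 / lam) ^ 2 ≤ κ ^ 2 := pow_le_pow_left₀ hr.le hcon 2
    have huniq : ∀ z ∈ K, z = (1 / 2 : ℝ) • (a + b) := by
      intro z hz
      rw [hKab] at hz
      have z1 := (mem_closedBall_iff hr.le).1 hz.1
      have z2 := (mem_closedBall_iff hr.le).1 hz.2
      have hs : (z 0 - (a 0 + b 0) / 2) ^ 2 + (z 1 - (a 1 + b 1) / 2) ^ 2 ≤ 0 := by
        nlinarith
      have k0 : z 0 - (a 0 + b 0) / 2 = 0 := by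
        nlinarith [sq_nonneg (z 0 - (a 0 + b 0) / 2), sq_nonneg (z 1 - (a 1 + b 1) / 2)]
      have k1 : z 1 - (a 1 + b 1) / 2 = 0 := by
        nlinarith [sq_nonneg (z 0 - (a 0 + b 0) / 2), sq_nonneg (z 1 - (a 1 + b 1) / 2)]
      exact plane_ext (by simp; linarith) (by simp; linarith)
    have e : suppPt K π = suppPt K 0 :=
      (huniq _ (suppPt_mem hb π)).trans (huniq _ (suppPt_mem hb 0)).symm
    have s1 := suppPt_spec hb π
    rw [e] at s1
    exact not_isSupp_antipodal hb (suppPt_spec hb 0) (by rwa [zero_add])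
  have hq1 : κ / (1 / lam) < 1 := (div_lt_one hr).2 hlt
  have hq0 : 0 ≤ κ / (1 / lam) := by positivity
  refine ⟨ω, arccos (κ / (1 / lam)), ?_, arccos_pos.2 hq1, arccos_le_pi_div_two.2 hq0⟩
  rw [cos_arccos (by linarith) hq1.le, mul_div_cancel₀ _ hr.ne']
  apply plane_ext
  · simp only [PiLp.sub_apply, PiLp.smul_apply, dir_zero, smul_eq_mul]; linarith
  · simp only [PiLp.sub_apply, PiLp.smul_apply, dir_one, smul_eq_mul]; linarith

lemma area_eq_of_lens (hlam : 0 < lam) (hK : IsLamConvexBody lam K)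
    (h : IsLamConvexLens lam K) :
    planarArea K = (1 / lam) ^ 2 *
      (prim (dens lam K) (2 * π) / 2 - sin (prim (dens lam K) (2 * π) / 2)) := by
  obtain ⟨-, a, b, hKab⟩ := h
  obtain ⟨ω, η, hab, hη0, hη⟩ := exists_lens_angle hlam hK hKab
  have hba : b - a = (2 * (1 / lam * cos η)) • dir (ω + π) := by
    have : dir (ω + π) = - dir ω := plane_ext (by simp) (by simp)
    rw [this, smul_neg, ← hab]; abel
  obtain ⟨p1, a1⟩ := lens_half hlam hK hKab hab hη0 hη
  obtain ⟨p2, a2⟩ := lens_half hlam hK (hKab.trans (inter_comm _ _)) hba hη0 hη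
  rw [show ω + π - π / 2 = ω - π / 2 + π by ring] at p2 a2
  have hsum := prim_shiftDens_add lam K (ω - π / 2)
  rw [p1, p2] at hsum
  rw [planarArea_eq hlam hK (ω - π / 2), a1, a2, ← hsum,
    show (2 * η + 2 * η) / 2 = 2 * η by ring]
  ring

end LamConvex

/-! ### Assembly of the theorem. -/

/-- The first conjunct says that the boundary length of `K` is finite, so that `boundaryLength K`
is the true length. -/
theorem mainTheorem7 (lam : ℝ) (hlam : 0 < lam) (K : Set (EuclideanSpace ℝ (Fin 2)))
    (hK : IsLamConvexBody lam K) :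
    Measure.hausdorffMeasure 1 (frontier K) < ⊤ ∧
    planarArea K ≥ boundaryLength K / (2 * lam)
      - 1 / lam ^ 2 * Real.sin (boundaryLength K * lam / 2) ∧
    (planarArea K = boundaryLength K / (2 * lam)
      - 1 / lam ^ 2 * Real.sin (boundaryLength K * lam / 2) ↔ IsLamConvexLens lam K) := by
  open LamConvex in
  refine ⟨?_, ?_⟩
  · rw [hausdorffMeasure_frontier hlam hK]
    exact ENNReal.ofReal_lt_top
  rw [bound_eq hlam hK]
  obtain ⟨p, hp1, hp2⟩ := exists_halving lam K
  have b1 := (density_shiftDens lam K p).le_arcArea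
  have b2 := (density_shiftDens lam K (p + Real.pi)).le_arcArea
  have harea := planarArea_eq hlam hK p
  have hpos := prim_dens_two_pi_pos hlam hK
  have hr : 0 < (1 / lam) ^ 2 := by positivity
  rw [hp1] at b1
  rw [hp2] at b2
  refine ⟨?_, fun heq => ?_, area_eq_of_lens hlam hK⟩
  · rw [harea]
    nlinarith
  · rw [harea] at heq
    have hsum : Density.arcArea (shiftDens lam K p)
        + Density.arcArea (shiftDens lam K (p + Real.pi))
        = 2 * (prim (dens lam K) (2 * Real.pi) / 2
          - Real.sin (prim (dens lam K) (2 * Real.pi) / 2)) := by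
      have := mul_left_cancel₀ hr.ne' (a := (1 / lam) ^ 2)
        (b := 1 / 2 * (Density.arcArea (shiftDens lam K p)
          + Density.arcArea (shiftDens lam K (p + Real.pi))))
        (c := prim (dens lam K) (2 * Real.pi) / 2
          - Real.sin (prim (dens lam K) (2 * Real.pi) / 2)) (by rw [← heq]; ring)
      linarith
    -- Both halves have the same lower bound, so equality in the sum gives equality in each.
    have s1 := half_structure hlam hK (p := p) (by rw [hp1]; linarith) (by rw [hp1]; linarith)
    have s2 := half_structure hlam hK (p := p + Real.pi) (by rw [hp2]; linarith)
      (by rw [hp2]; linarith)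
    rw [hp1] at s1
    rw [hp2] at s2
    exact lens_of_halves hlam hK s1 s2
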